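/- Definitions. Let $E\subset\mathbb C$ be a compact set whose complement is mapped conformally and bijectively, by a map $\Phi$ with $\Phi(z)=z+O(1/z)$ at infinity (the lemniscatic map of $E$), onto a lemniscatic domain $\mathcal L=\{w\in\widehat{\mathbb C}:|U(w)|>\mu\}$, where $|U(w)|=\prod_{j=1}^N|w-a_j|^{m_j}$ with pairwise distinct foci $a_1,\dots,a_N$, exponents $m_j>0$ with $\sum_j m_j=1$, and $\mu>0$. Put $\psi=\Phi^{-1}$. Let $(\alpha_j)_{j\ge1}$ be a sequence chosen from the foci such that, for some constant $A$, the number $N_{k,j}$ of indices $i\le k$ with $\alpha_i=a_j$ satisfies $|N_{k,j}-km_j|\le A$ for all $k,j$; put $u_k(w)=\prod_{i=1}^k(w-\alpha_i)$. The Faber–Walsh polynomials $b_0,b_1,\dots$ for $E$ and $(\alpha_j)$ are the polynomials with $$\frac{\psi'(w)}{\psi(w)-z}=\sum_{k=0}^\infty\frac{b_k(z)}{u_{k+1}(w)}\qquad\text{whenever } |U(\Phi(z))|=\sigma\mu<|U(w)|,\ \sigma>1.$$ The $d$-th Chebyshev polynomial $T_d(\cdot\,;E)$ is the unique monic polynomial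 of degree $d$ with least maximum norm on $E$. Theorem. (a) Let $n\ge1$, $0<C<D$ and $E=\bigcup_{j=1}^n e^{2\pi i j/n}[C,D]$. Take the cyclic sequence of foci $\alpha_j=e^{2\pi i(j-1)/n}\,r$, $j\ge1$, where $r=\Big(\frac{D^{n/2}+C^{n/2}}{2}\Big)^{2/n}$ if $n\ge2$, and $r=\frac{C+D}{2}$ if $n=1$. Then the Faber–Walsh polynomials for $E$ and $(\alpha_j)$ exist, and $b_{nk}=T_{nk}(\cdot\,;E)$ for all $k\ge0$. (b) Let $A<B<C<D$ be real numbers with $B-A=D-C$, let $E=[A,B]\cup[C,D]$, and take $(\alpha_j)_{j\ge1}=\big(\frac{C+D}2,\frac{A+B}2,\frac{C+D}2,\frac{A+B}2,\dots\big)$. Then the Faber–Walsh polynomials for $E$ and $(\alpha_j)$ exist, and $b_{2k}=T_{2k}(\cdot\,;E)$ for all $k\ge0$. -/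

import Mathlib

open Filter Bornology Asymptotics Polynomial

noncomputable section

/-- The modulus `|U(w)| = ∏ j, |w - a j| ^ (m j)`. -/
def absU {N : ℕ} (a : Fin N → ℂ) (m : Fin N → ℝ) (w : ℂ) : ℝ :=
  ∏ j, ‖w - a j‖ ^ m j

/-- The finite points of the lemniscatic domain `{w : |U(w)| > μ}` of the extended plane
(the point at infinity always belongs to that domain). -/
def lemniscaticDomain {N : ℕ} (a : Fin N → ℂ) (m : Fin N → ℝ) (μ : ℝ) : Set ℂ :=
  {w | μ < absU a m w}

/-- `Φ` is the lemniscatic map of `E`, onto the lemniscatic domain with foci `a`, exponents `m` and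
level `μ`: a conformal bijection of the complement of `E` onto that domain which fixes the
point at infinity and satisfies `Φ(z) = z + O(1/z)` there. -/
structure IsLemniscaticMap (E : Set ℂ) {N : ℕ} (a : Fin N → ℂ) (m : Fin N → ℝ) (μ : ℝ)
    (Φ : ℂ → ℂ) : Prop where
  foci_injective : Function.Injective a
  exponent_pos : ∀ j, 0 < m j
  exponent_sum : ∑ j, m j = 1
  level_pos : 0 < μ
  differentiableOn : DifferentiableOn ℂ Φ Eᶜ
  bijOn : Set.BijOn Φ Eᶜ (lemniscaticDomain a m μ)
  at_infinity : (fun z => Φ z - z) =O[cobounded ℂ] fun z => z⁻¹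

/-- The sequence `α 0, α 1, …` is chosen from the foci `a`, and the number of times `a j` occurs
among the first `k` terms differs from `k * m j` by at most a constant. -/
def IsAdmissibleSeq {N : ℕ} (a : Fin N → ℂ) (m : Fin N → ℝ) (α : ℕ → ℂ) : Prop :=
  (∀ i, α i ∈ Set.range a) ∧
    ∃ A : ℝ, 0 < A ∧ ∀ (j : Fin N) (k : ℕ),
      |(((Finset.range k).filter fun i => α i = a j).card : ℝ) - k * m j| ≤ A

/-- `u_k(w) = ∏_{i < k} (w - α i)`. -/
def nodePoly (α : ℕ → ℂ) (k : ℕ) (w : ℂ) : ℂ :=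
  ∏ i ∈ Finset.range k, (w - α i)

/-- The inverse map `ψ` of `Φ`, defined on the image of the complement of `E`. -/
def inverseMap (E : Set ℂ) (Φ : ℂ → ℂ) : ℂ → ℂ :=
  Function.invFunOn Φ Eᶜ

/-- `b 0, b 1, …` are the Faber--Walsh polynomials for `E` and `α`: with the lemniscatic map `Φ` of
`E` and `ψ = Φ⁻¹`, the sequence `α` is admissible for the foci and exponents of the lemniscatic
domain, and `ψ'(w) / (ψ(w) - z) = ∑ k, b k (z) / u_{k+1}(w)` whenever `σ > 1`, `z` lies on the
level curve `|U(Φ(z))| = σ μ` and `w` lies outside the level curve `|U| = σ μ`. -/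
def IsFaberWalsh (E : Set ℂ) (α : ℕ → ℂ) (b : ℕ → ℂ[X]) : Prop :=
  ∃ (N : ℕ) (a : Fin N → ℂ) (m : Fin N → ℝ) (μ : ℝ) (Φ : ℂ → ℂ),
    IsLemniscaticMap E a m μ Φ ∧ IsAdmissibleSeq a m α ∧
      ∀ σ : ℝ, 1 < σ → ∀ z ∈ Eᶜ, absU a m (Φ z) = σ * μ → ∀ w : ℂ, σ * μ < absU a m w →
        HasSum (fun k => (b k).eval z / nodePoly α (k + 1) w)
          (deriv (inverseMap E Φ) w / (inverseMap E Φ w - z))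

/-- The maximum norm of `p` on `E`. -/
def supNormOn (E : Set ℂ) (p : ℂ[X]) : ℝ :=
  sSup ((fun z => ‖p.eval z‖) '' E)

/-- `p` has least maximum norm on `E` among the monic polynomials of degree `d`. -/
def IsChebyshevPoly (E : Set ℂ) (d : ℕ) (p : ℂ[X]) : Prop :=
  p.Monic ∧ p.natDegree = d ∧
    ∀ q : ℂ[X], q.Monic → q.natDegree = d → supNormOn E p ≤ supNormOn E q

/-- `⋃ j = 1, …, n` of the rotated intervals `exp (2 π i j / n) [C, D]`. -/
def starSet (n : ℕ) (C D : ℝ) : Set ℂ :=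
  ⋃ j ∈ Finset.Icc 1 n,
    (fun x : ℝ => Complex.exp (2 * Real.pi * Complex.I * j / n) * x) '' Set.Icc C D

/-- The common modulus of the foci of the lemniscatic domain belonging to `starSet n C D`. -/
def starRadius (n : ℕ) (C D : ℝ) : ℝ :=
  if n = 1 then (C + D) / 2
  else ((D ^ ((n : ℝ) / 2) + C ^ ((n : ℝ) / 2)) / 2) ^ (2 / (n : ℝ))

/-- The cyclic sequence of foci for `starSet n C D`. -/
def starFoci (n : ℕ) (C D : ℝ) (j : ℕ) : ℂ :=
  Complex.exp (2 * Real.pi * Complex.I * j / n) * starRadius n C D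

/-- The union of the real intervals `[A, B]` and `[C, D]`, as a set of complex numbers. -/
def twoIntervals (A B C D : ℝ) : Set ℂ :=
  (fun x : ℝ => (x : ℂ)) '' (Set.Icc A B ∪ Set.Icc C D)

/-- The sequence `(C + D) / 2, (A + B) / 2, (C + D) / 2, (A + B) / 2, …`. -/
def twoIntervalFoci (A B C D : ℝ) (j : ℕ) : ℂ :=
  if Even j then (((C + D) / 2 : ℝ) : ℂ) else (((A + B) / 2 : ℝ) : ℂ)

end

/-! ### Holomorphic functions near infinity -/

/-! Both sets have the form `(z - t₁) ^ n ∈ [Q ^ 2, P ^ 2]`. Such a set, a star, is the preimage of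
`[-2, 2]` under `v(z) = (z - t₁) ^ n / M - ρ - ρ⁻¹` for suitable `M > 0` and `0 < ρ < 1`, so
`StarParam` handles both at once.

Existence. Off the star write `v(z) = ζ + ζ⁻¹` with `|ζ| > 1`. Then `(z - t₁) ^ n = M (ζ + ρ⁻¹) (1 +
ρ/ζ)`, and `|ρ/ζ| < 1`, so the principal `n`-th root of the last factor is holomorphic. Dividing it
out gives the lemniscatic map: `(w - t₂) ^ n = M (ζ + ρ⁻¹)`, that is, `ζ = η(w)` with `M η(w) =
u_n(w)`. With `x = ψ(w) - t₁` and `u = z - t₁` one has `x ^ n - u ^ n = M (η + η⁻¹ - v(z))`, so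
factoring `x ^ n - u ^ n` reduces the generating function to the Faber kernel of `[-2, 2]` times
binomial series in `η⁻¹` and powers of `w - t₂` (`deriv_inner_div`). Rewriting those powers in a
Newton basis built on the foci yields the expansion in `1 / u_{k+1}` (`hasSum_faberWalsh`). At
indices `n k` only the `l = 0` term survives, and `b_{nk} = M ^ k C_k(v)` for `k ≥ 1`, where `C_k(ζ
+ ζ⁻¹) = ζ ^ k + ζ⁻¹ ^ k`; also `b_0 = 1`.

Uniqueness. The Faber–Walsh property allows any lemniscatic data, so the data must be shown to be
forced. Admissibility determines exponents and foci, a maximum principle comparing `ζ` with `η ∘ Φ`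
determines the level and `Φ` (`eq_outer_of_isLemniscaticMap`), and letting `w → ∞` determines the
coefficients (`coeff_eq_zero_of_hasSum_div_nodePoly`).

Chebyshev property. `M ^ k C_k(v)` is monic of degree `n k` and attains its norm `2 M ^ k` with
alternating signs on the `k + 1` fibres of `v` over the extremal points of `C_k`. Summing a
competitor's difference over each fibre reduces to the classical alternation argument
(`eq_chebyshev_of_forall_norm_le`). -/

theorem eventually_cobounded_iff_exists_norm {p : ℂ → Prop} :
    (∀ᶠ z in cobounded ℂ, p z) ↔ ∃ R : ℝ, ∀ z, R < ‖z‖ → p z := by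
  rw [← comap_norm_atTop, eventually_comap, eventually_atTop]
  constructor
  · rintro ⟨R, hR⟩
    exact ⟨R, fun z hz => hR _ hz.le z rfl⟩
  · rintro ⟨R, hR⟩
    exact ⟨R + 1, fun b hb z hz => hR z (by linarith)⟩

theorem eventually_lt_norm_cobounded (R : ℝ) : ∀ᶠ z in cobounded ℂ, R < ‖z‖ :=
  eventually_cobounded_iff_exists_norm.2 ⟨R, fun _ h => h⟩

/-- Removable singularity theorem in the coordinate `s = z⁻¹`. -/
theorem analyticAt_inversion_of_tendsto {F : ℂ → ℂ} {c : ℂ}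
    (hd : ∀ᶠ z in cobounded ℂ, DifferentiableAt ℂ F z) (hF : Tendsto F (cobounded ℂ) (nhds c)) :
    AnalyticAt ℂ (Function.update (fun s => F s⁻¹) 0 c) 0 := by
  apply Complex.analyticAt_of_differentiable_on_punctured_nhds_of_continuousAt
  · filter_upwards [tendsto_inv₀_nhdsNE_zero.eventually hd, self_mem_nhdsWithin] with s hs hs0
    have h0 : s ≠ 0 := hs0
    have h1 : DifferentiableAt ℂ (fun s => F s⁻¹) s :=
      DifferentiableAt.comp s hs (differentiableAt_inv h0)
    refine h1.congr_of_eventuallyEq ?_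
    filter_upwards [isOpen_ne.mem_nhds h0] with t ht
    exact Function.update_of_ne ht _ _
  · rw [continuousAt_update_same]
    exact hF.comp tendsto_inv₀_nhdsNE_zero

/-- The open mapping theorem at the point infinity, from the local dichotomy for `F(s⁻¹)` at `s =
0`. -/
theorem eventually_eq_or_frequently_of_tendsto_cobounded {F : ℂ → ℂ} {c : ℂ}
    (hd : ∀ᶠ z in cobounded ℂ, DifferentiableAt ℂ F z) (hF : Tendsto F (cobounded ℂ) (nhds c)) :
    (∀ᶠ z in cobounded ℂ, F z = c) ∨
      ∀ s ∈ cobounded ℂ, ∃ t ∈ nhds c, ∀ w ∈ t, w ≠ c → ∃ z ∈ s, F z = w := by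
  have hA := analyticAt_inversion_of_tendsto hd hF
  rcases hA.eventually_constant_or_nhds_le_map_nhds with h | h
  · left
    have h1 := tendsto_inv₀_cobounded.eventually h
    filter_upwards [h1, eventually_ne_cobounded (0 : ℂ)] with z hz hz0
    rwa [Function.update_self, Function.update_of_ne (inv_ne_zero hz0), inv_inv] at hz
  · right
    intro s hs
    rw [Function.update_self] at h
    have hs' : {u : ℂ | u ≠ 0 → u⁻¹ ∈ s} ∈ nhds (0 : ℂ) := by
      have := tendsto_inv₀_nhdsNE_zero.eventually hs
      rw [eventually_nhdsWithin_iff] at this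
      exact this
    refine ⟨_, h (image_mem_map hs'), ?_⟩
    rintro w ⟨u, hu, rfl⟩ hw
    have hu0 : u ≠ 0 := by
      rintro rfl
      exact hw (Function.update_self _ _ _)
    exact ⟨u⁻¹, hu hu0, by rw [Function.update_of_ne hu0]⟩

/-- A maximum principle for functions which are close to `1` near infinity and at most `1` in the
limit on the boundary. -/
theorem eqOn_one_of_tendsto_one_of_norm_lt {U : Set ℂ} {F : ℂ → ℂ} (hU : IsOpen U)
    (hUc : IsPreconnected U) (hinf : ∀ᶠ z in cobounded ℂ, z ∈ U) (hF : DifferentiableOn ℂ F U)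
    (hlim : Tendsto F (cobounded ℂ) (nhds 1))
    (hK : ∀ v : ℝ, 1 < v → ∃ K ⊆ U, IsCompact K ∧ ∀ z ∈ U, z ∉ K → ‖F z‖ < v) :
    ∀ z ∈ U, F z = 1 := by
  have hd : ∀ᶠ z in cobounded ℂ, DifferentiableAt ℂ F z :=
    hinf.mono fun z hz => hF.differentiableAt (hU.mem_nhds hz)
  rcases eventually_eq_or_frequently_of_tendsto_cobounded hd hlim with h | h
  · obtain ⟨R, hR⟩ := eventually_cobounded_iff_exists_norm.1 (h.and hinf)
    have hz0 : ((|R| + 1 : ℝ) : ℂ) ∈ {z : ℂ | R < ‖z‖} := by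
      simp only [Set.mem_ofPred_eq, Complex.norm_real, Real.norm_eq_abs]
      rw [abs_of_nonneg (by positivity)]
      linarith [le_abs_self R]
    refine (hF.analyticOnNhd hU).eqOn_of_preconnected_of_eventuallyEq
      (g := fun _ => 1) analyticOnNhd_const hUc (hR _ hz0).2 ?_
    filter_upwards [(isOpen_lt continuous_const continuous_norm).mem_nhds hz0] with z hz
    exact (hR _ hz).1
  · exfalso
    obtain ⟨t, ht, hts⟩ := h U hinf
    obtain ⟨ε, hε, hεt⟩ := Metric.mem_nhds_iff.1 ht
    -- `F` is open at infinity, so it takes a real value above `1`. The maximum of `|F|` over `K`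
    -- for this level is then a global interior maximum; `F` is constant, against its limit `1`.
    obtain ⟨z, hz, hFz⟩ := hts (1 + (ε / 2 : ℝ)) (hεt (by
      rw [Metric.mem_ball, dist_eq_norm, add_sub_cancel_left, Complex.norm_real,
        Real.norm_of_nonneg (by positivity)]
      linarith)) (by
      simp [hε.ne'])
    have hv : 1 < ‖F z‖ := by
      rw [hFz, ← Complex.ofReal_one, ← Complex.ofReal_add, Complex.norm_real,
        Real.norm_of_nonneg (by positivity)]
      linarith
    obtain ⟨K, hKU, hKc, hKout⟩ := hK _ hv
    have hzK : z ∈ K := by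
      by_contra hzK
      exact lt_irrefl _ (hKout z hz hzK)
    obtain ⟨x, hxK, hx⟩ := hKc.exists_isMaxOn ⟨z, hzK⟩ (hF.continuousOn.mono hKU).norm
    have hmax : IsMaxOn (norm ∘ F) U x := by
      intro y hy
      by_cases hyK : y ∈ K
      · exact hx hyK
      · exact (hKout y hy hyK).le.trans (hx hzK)
    have hconst := Complex.eqOn_of_isPreconnected_of_isMaxOn_norm hUc hU hF (hKU hxK) hmax
    have : Tendsto F (cobounded ℂ) (nhds (F x)) :=
      tendsto_const_nhds.congr' (hinf.mono fun y hy => (hconst hy).symm)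
    have h1 := tendsto_nhds_unique this hlim
    have h2 : ‖F z‖ ≤ ‖F x‖ := hx hzK
    rw [h1, norm_one] at h2
    linarith

/-- Openness at infinity of `1 / Φ`, which tends to `0` without vanishing: every point near infinity
is the image of a point near infinity. -/
theorem exists_norm_lt_of_isBigO_inv {Φ : ℂ → ℂ}
    (hd : ∀ᶠ z in cobounded ℂ, DifferentiableAt ℂ Φ z)
    (h : (fun z => Φ z - z) =O[cobounded ℂ] fun z => z⁻¹) :
    ∀ R : ℝ, ∃ R' : ℝ, ∀ w : ℂ, R' < ‖w‖ → ∃ z, R < ‖z‖ ∧ Φ z = w := by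
  have h0 : Tendsto (fun z => Φ z - z) (cobounded ℂ) (nhds 0) :=
    h.trans_tendsto tendsto_inv₀_cobounded
  have hΦ : Tendsto Φ (cobounded ℂ) (cobounded ℂ) := by
    rw [← tendsto_norm_atTop_iff_cobounded]
    have h1 : Tendsto (fun z : ℂ => ‖z‖ - ‖Φ z - z‖) (cobounded ℂ) atTop := by
      have := h0.norm
      exact tendsto_norm_cobounded_atTop.atTop_add this.neg |>.congr fun z => by ring
    refine tendsto_atTop_mono (fun z => ?_) h1
    have := norm_sub_norm_le z (z - Φ z)
    rw [sub_sub_cancel, norm_sub_rev z (Φ z)] at this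
    exact this
  intro R
  have hne : ∀ᶠ z in cobounded ℂ, Φ z ≠ 0 := hΦ.eventually (eventually_ne_cobounded 0)
  have hd' : ∀ᶠ z in cobounded ℂ, DifferentiableAt ℂ (fun z => (Φ z)⁻¹) z := by
    filter_upwards [hd, hne] with z h1 h2 using h1.inv h2
  rcases eventually_eq_or_frequently_of_tendsto_cobounded hd'
    (tendsto_inv₀_cobounded.comp hΦ) with h1 | h1
  · obtain ⟨z, hz, hz'⟩ := (h1.and hne).exists
    exact absurd hz (inv_ne_zero hz')
  · obtain ⟨t, ht, hts⟩ := h1 {z | R < ‖z‖} (eventually_lt_norm_cobounded R)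
    obtain ⟨R', hR'⟩ := eventually_cobounded_iff_exists_norm.1
      ((tendsto_inv₀_cobounded.eventually ht).and (eventually_ne_cobounded 0))
    refine ⟨R', fun w hw => ?_⟩
    obtain ⟨h2, h3⟩ := hR' w hw
    obtain ⟨z, hz, hzw⟩ := hts _ h2 (inv_ne_zero h3)
    exact ⟨z, hz, inv_injective hzw⟩

/-- An injective map on a set with two points is not constant, hence open, and openness is
continuity of the inverse. -/
theorem continuousOn_invFunOn_of_differentiableOn {U : Set ℂ} {f : ℂ → ℂ} (hU : IsOpen U)
    (hUc : IsPreconnected U) (hf : DifferentiableOn ℂ f U) (hinj : Set.InjOn f U)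
    (hne : U.Nontrivial) : ContinuousOn (Function.invFunOn f U) (f '' U) := by
  have hopen : ∀ s ⊆ U, IsOpen s → IsOpen (f '' s) := by
    rcases (hf.analyticOnNhd hU).is_constant_or_isOpen hUc with ⟨w, hw⟩ | h
    · obtain ⟨x, hx, y, hy, hxy⟩ := hne
      exact absurd (hinj hx hy ((hw x hx).trans (hw y hy).symm)) hxy
    · exact h
  rw [continuousOn_iff']
  intro t ht
  refine ⟨_, hopen (U ∩ t) Set.inter_subset_left (hU.inter ht), ?_⟩
  ext w
  constructor
  · rintro ⟨hw, z, hz, rfl⟩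
    rw [Set.mem_preimage, hinj.leftInvOn_invFunOn hz] at hw
    exact ⟨⟨z, ⟨hz, hw⟩, rfl⟩, z, hz, rfl⟩
  · rintro ⟨⟨z, ⟨hz, hw⟩, rfl⟩, -⟩
    refine ⟨?_, z, hz, rfl⟩
    rwa [Set.mem_preimage, hinj.leftInvOn_invFunOn hz]

/-! ### Uniqueness of expansions in reciprocal node polynomials -/

theorem nodePoly_succ (α : ℕ → ℂ) (k : ℕ) (w : ℂ) :
    nodePoly α (k + 1) w = nodePoly α k w * (w - α k) :=
  Finset.prod_range_succ _ _

theorem nodePoly_add (α : ℕ → ℂ) (k l : ℕ) (w : ℂ) :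
    nodePoly α (k + l) w = nodePoly α k w * nodePoly (fun i => α (k + i)) l w :=
  Finset.prod_range_add _ _ _

theorem nodePoly_ne_zero {α : ℕ → ℂ} {w : ℂ} (h : ∀ i, w ≠ α i) (k : ℕ) : nodePoly α k w ≠ 0 :=
  Finset.prod_ne_zero_iff.2 fun i _ => sub_ne_zero.2 (h i)

/-- If the coefficients before `d k` vanish, multiplying the series by `u_{k+1}` leaves `d k` plus
terms that tend to `0` as `w → ∞`. Dominated convergence then gives `d k = 0`. -/
theorem coeff_eq_zero_of_hasSum_div_nodePoly {α : ℕ → ℂ} {A : ℝ} (hα : ∀ i, ‖α i‖ ≤ A)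
    {d : ℕ → ℂ}
    (h : ∀ᶠ w in cobounded ℂ, HasSum (fun k => d k / nodePoly α (k + 1) w) 0) : d = 0 := by
  have hA : 0 ≤ A := (norm_nonneg _).trans (hα 0)
  have hbig : ∀ᶠ w in cobounded ℂ, A < ‖w‖ := eventually_lt_norm_cobounded A
  have hne : ∀ {w : ℂ}, A < ‖w‖ → ∀ i, w ≠ α i := by
    rintro w hw i rfl
    exact absurd (hα i) (not_le.2 hw)
  have hpos : ∀ {w : ℂ} (i : ℕ), ‖w‖ - A ≤ ‖w - α i‖ := fun {w} i => by
    linarith [norm_sub_norm_le w (α i), hα i]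
  obtain ⟨w₀, hw₀, hw₀A⟩ := (h.and hbig).exists
  -- Convergence at the single point `w₀` bounds the growth of `d`, which supplies the dominating
  -- geometric series for all large `w`.
  obtain ⟨B, hB⟩ : ∃ B, ∀ k, ‖d k / nodePoly α (k + 1) w₀‖ ≤ B := by
    obtain ⟨B, hB⟩ := hw₀.summable.tendsto_atTop_zero.norm.bddAbove_range
    exact ⟨B, fun k => hB ⟨k, rfl⟩⟩
  ext k
  induction k using Nat.strong_induction_on with
  | _ k ih =>
  set c : ℝ := B * ‖nodePoly α (k + 1) w₀‖ with hc
  have hB0 : 0 ≤ B := (norm_nonneg _).trans (hB 0)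
  have key : ∀ᶠ w in cobounded ℂ,
      HasSum (fun j => d (k + j) / nodePoly (fun i => α (k + 1 + i)) j w) 0 := by
    filter_upwards [h, hbig] with w hw hwA
    have h1 := (hasSum_nat_add_iff' k).2 hw
    rw [Finset.sum_eq_zero (fun i hi => by simp [ih i (Finset.mem_range.1 hi)]), sub_zero] at h1
    have h2 := h1.mul_left (nodePoly α (k + 1) w)
    rw [mul_zero] at h2
    refine h2.congr_fun fun j => ?_
    rw [show j + k + 1 = (k + 1) + j by ring, nodePoly_add α (k + 1) j, add_comm j k, ← mul_div_assoc,
      mul_div_mul_left _ _ (nodePoly_ne_zero (hne hwA) (k + 1))]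
  have hτ : Tendsto (fun w : ℂ => (‖w₀‖ + A) / (‖w‖ - A)) (cobounded ℂ) (nhds 0) := by
    apply Tendsto.const_div_atTop
    exact tendsto_atTop_add_const_right _ _ tendsto_norm_cobounded_atTop
  have hbound : ∀ w : ℂ, A < ‖w‖ → ∀ j,
      ‖d (k + j) / nodePoly (fun i => α (k + 1 + i)) j w‖ ≤ c * ((‖w₀‖ + A) / (‖w‖ - A)) ^ j := by
    intro w hwA j
    have h1 : ‖nodePoly (fun i => α (k + 1 + i)) j w₀‖ ≤ (‖w₀‖ + A) ^ j := by
      rw [nodePoly, norm_prod]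
      refine (Finset.prod_le_prod (fun i _ => norm_nonneg _) fun i _ =>
        (norm_sub_le w₀ (α (k + 1 + i))).trans (add_le_add le_rfl (hα _))).trans_eq (by simp)
    have h2 : (‖w‖ - A) ^ j ≤ ‖nodePoly (fun i => α (k + 1 + i)) j w‖ := by
      rw [nodePoly, norm_prod]
      refine Eq.trans_le (by simp) (Finset.prod_le_prod (s := Finset.range j)
        (f := fun _ => ‖w‖ - A) (fun i _ => by linarith) fun i _ => hpos _)
    have h3 : ‖d (k + j)‖ ≤ c * (‖w₀‖ + A) ^ j := by
      have h4 := hB (k + j)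
      have h5 := nodePoly_ne_zero (hne hw₀A) (k + j + 1)
      rw [norm_div, div_le_iff₀ (norm_pos_iff.2 h5), show k + j + 1 = (k + 1) + j by ring,
        nodePoly_add α (k + 1) j, norm_mul, ← mul_assoc] at h4
      exact h4.trans (mul_le_mul_of_nonneg_left h1 (by positivity))
    have h6 : 0 < (‖w‖ - A) ^ j := pow_pos (by linarith) _
    rw [norm_div, div_pow, ← mul_div_assoc]
    exact div_le_div₀ (by positivity) h3 h6 h2
  have hlim : Tendsto (fun w => ∑' j, d (k + j) / nodePoly (fun i => α (k + 1 + i)) j w)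
      (cobounded ℂ) (nhds (∑' j, if j = 0 then d k else 0)) := by
    refine tendsto_tsum_of_dominated_convergence (bound := fun j => c * (1 / 2) ^ j)
      (summable_geometric_two.mul_left c) ?_ ?_
    · intro j
      rcases Nat.eq_zero_or_pos j with rfl | hj
      · simp [nodePoly]
      · rw [if_neg hj.ne']
        refine squeeze_zero_norm' (hbig.mono fun w hw => hbound w hw j) ?_
        simpa [zero_pow hj.ne'] using (hτ.pow j).const_mul c
    · filter_upwards [hτ.eventually (gt_mem_nhds (show (0 : ℝ) < 1 / 2 by norm_num)), hbig]
        with w hw hwA j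
      have : 0 ≤ (‖w₀‖ + A) / (‖w‖ - A) := div_nonneg (by positivity) (by linarith)
      exact (hbound w hwA j).trans (by gcongr)
  have hzero : Tendsto (fun w => ∑' j, d (k + j) / nodePoly (fun i => α (k + 1 + i)) j w)
      (cobounded ℂ) (nhds 0) :=
    tendsto_const_nhds.congr' (key.mono fun w hw => hw.tsum_eq.symm)
  have := tendsto_nhds_unique hlim hzero
  rwa [tsum_ite_eq] at this

/-! ### The inverse of the Joukowski map -/

/-- The interval `[-2, 2]`, as a set of complex numbers. -/
def joukowskiSlit : Set ℂ := Complex.ofReal '' Set.Icc (-2) 2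

/-- The solution `ζ` of `ζ + ζ⁻¹ = v` with `1 < ‖ζ‖`, for `v` outside `joukowskiSlit`. -/
noncomputable def joukowskiInv (v : ℂ) : ℂ := v / 2 * (1 + (1 - 4 / v ^ 2) ^ (1 / 2 : ℂ))

theorem isCompact_joukowskiSlit : IsCompact joukowskiSlit :=
  isCompact_Icc.image Complex.continuous_ofReal

theorem zero_mem_joukowskiSlit : (0 : ℂ) ∈ joukowskiSlit := ⟨0, by norm_num, by simp⟩

/-- `1 - 4 / v ^ 2 ≤ 0` forces `0 < v ^ 2 ≤ 4`, so the principal square root in `joukowskiInv` is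
holomorphic exactly where it is needed. -/
theorem one_sub_four_div_sq_mem_slitPlane {v : ℂ} (hv : v ∉ joukowskiSlit) :
    1 - 4 / v ^ 2 ∈ Complex.slitPlane := by
  have hv0 : v ≠ 0 := fun h => hv (h ▸ zero_mem_joukowskiSlit)
  rw [Complex.mem_slitPlane_iff_not_le_zero]
  intro hle
  obtain ⟨hre, him⟩ := Complex.le_def.1 hle
  set x : ℝ := (4 / v ^ 2).re with hx
  have hx4 : 4 / v ^ 2 = (x : ℂ) := by
    apply Complex.ext
    · simp [hx]
    · simpa using him
  have hx1 : 1 ≤ x := by simpa using hre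
  have hx0 : (x : ℂ) ≠ 0 := Complex.ofReal_ne_zero.2 (by linarith)
  have hvv : v ^ 2 = ((2 / √x : ℝ) : ℂ) ^ 2 := by
    rw [← Complex.ofReal_pow, div_pow, Real.sq_sqrt (by linarith)]
    push_cast
    rw [← hx4]
    field_simp
    norm_num
  have hs1 : 1 ≤ √x := Real.one_le_sqrt.2 hx1
  have hle2 : 2 / √x ≤ 2 := div_le_self (by norm_num) hs1
  have hge : 0 ≤ 2 / √x := by positivity
  rcases sq_eq_sq_iff_eq_or_eq_neg.1 hvv with h | h
  · exact hv ⟨2 / √x, ⟨by linarith, hle2⟩, h.symm⟩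
  · exact hv ⟨-(2 / √x), ⟨by linarith, by linarith⟩, by rw [h]; simp⟩

theorem re_cpow_pos {z a : ℂ} (hz : z ∈ Complex.slitPlane) (ha : a = 1 / 2) : 0 < (z ^ a).re := by
  rw [ha, Complex.cpow_def_of_ne_zero (Complex.slitPlane_ne_zero hz), Complex.exp_re]
  have h1 : (Complex.log z * (1 / 2)).im = z.arg / 2 := by
    rw [show (1 / 2 : ℂ) = ((1 / 2 : ℝ) : ℂ) by norm_num, Complex.im_mul_ofReal, Complex.log_im]
    ring
  rw [h1]
  refine mul_pos (Real.exp_pos _) (Real.cos_pos_of_mem_Ioo ⟨?_, ?_⟩)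
  · linarith [Complex.neg_pi_lt_arg z]
  · have := (Complex.mem_slitPlane_iff_arg.1 hz).1
    have := lt_of_le_of_ne (Complex.arg_le_pi z) this
    linarith

/-- With `s` the square root, `v / 2 * (1 + s)` and `v / 2 * (1 - s)` are mutually inverse with sum
`v`, and `Re s > 0` makes the first the larger one. -/
theorem joukowskiInv_spec {v : ℂ} (hv : v ∉ joukowskiSlit) :
    1 < ‖joukowskiInv v‖ ∧ joukowskiInv v + (joukowskiInv v)⁻¹ = v := by
  have hv0 : v ≠ 0 := fun h => hv (h ▸ zero_mem_joukowskiSlit)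
  have hslit := one_sub_four_div_sq_mem_slitPlane hv
  have hre := re_cpow_pos hslit rfl
  set s := (1 - 4 / v ^ 2) ^ (1 / 2 : ℂ) with hs
  have hs2 : s ^ 2 = 1 - 4 / v ^ 2 := by
    have := Complex.cpow_nat_inv_pow (1 - 4 / v ^ 2) two_ne_zero
    rwa [Nat.cast_ofNat, ← one_div] at this
  have hJ : joukowskiInv v = v / 2 * (1 + s) := rfl
  have hmul : joukowskiInv v * (v / 2 * (1 - s)) = 1 := by
    rw [hJ, show v / 2 * (1 + s) * (v / 2 * (1 - s)) = v ^ 2 / 4 * (1 - s ^ 2) by ring, hs2]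
    field_simp
    ring
  have hinv : (joukowskiInv v)⁻¹ = v / 2 * (1 - s) := inv_eq_of_mul_eq_one_right hmul
  refine ⟨?_, by rw [hinv, hJ]; ring⟩
  have hlt : ‖1 - s‖ < ‖1 + s‖ := by
    rw [← sq_lt_sq₀ (norm_nonneg _) (norm_nonneg _), ← Complex.normSq_eq_norm_sq,
      ← Complex.normSq_eq_norm_sq, Complex.normSq_apply, Complex.normSq_apply]
    simp
    nlinarith
  have hlt' : ‖(joukowskiInv v)⁻¹‖ < ‖joukowskiInv v‖ := by
    rw [hinv, hJ, norm_mul, norm_mul]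
    have : 0 < ‖v / 2‖ := norm_pos_iff.2 (by simp [hv0])
    gcongr
  rw [norm_inv] at hlt'
  by_contra hle
  have h0 : 0 < ‖joukowskiInv v‖ := norm_pos_iff.2 (left_ne_zero_of_mul_eq_one hmul)
  have := (one_le_inv₀ h0).2 (not_lt.1 hle)
  linarith

/-- Circles `|ζ| = const` go to ellipses with foci `±2`. This expresses `|ζ|` through a function of
`v` that is continuous on the whole plane, slit included. -/
theorem norm_sub_two_add_norm_add_two {ζ : ℂ} (hζ : ζ ≠ 0) :
    ‖ζ + ζ⁻¹ - 2‖ + ‖ζ + ζ⁻¹ + 2‖ = 2 * (‖ζ‖ + ‖ζ‖⁻¹) := by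
  have h0 : ‖ζ‖ ≠ 0 := norm_ne_zero_iff.2 hζ
  have h1 : ζ + ζ⁻¹ - 2 = (ζ - 1) ^ 2 / ζ := by field_simp; ring
  have h2 : ζ + ζ⁻¹ + 2 = (ζ + 1) ^ 2 / ζ := by field_simp; ring
  have h3 := parallelogram_law_with_norm ℝ ζ 1
  rw [norm_one] at h3
  rw [h1, h2, norm_div, norm_div, norm_pow, norm_pow]
  field_simp
  linarith

theorem norm_sub_two_add_norm_add_two_of_mem {v : ℂ} (hv : v ∈ joukowskiSlit) :
    ‖v - 2‖ + ‖v + 2‖ = 4 := by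
  obtain ⟨x, ⟨h1, h2⟩, rfl⟩ := hv
  rw [show (x : ℂ) - 2 = ((x - 2 : ℝ) : ℂ) by push_cast; ring,
    show (x : ℂ) + 2 = ((x + 2 : ℝ) : ℂ) by push_cast; ring, Complex.norm_real, Complex.norm_real,
    Real.norm_of_nonpos (by linarith), Real.norm_of_nonneg (by linarith)]
  ring

theorem two_lt_add_inv {x : ℝ} (hx : 1 < x) : 2 < x + x⁻¹ := by
  have : x + x⁻¹ - 2 = (x - 1) ^ 2 / x := by field_simp; ring
  have h2 : 0 < (x - 1) ^ 2 / x := by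
    have : 0 < x - 1 := by linarith
    positivity
  linarith

theorem add_inv_notMem_joukowskiSlit {ζ : ℂ} (hζ : 1 < ‖ζ‖) : ζ + ζ⁻¹ ∉ joukowskiSlit := by
  intro h
  have h1 := norm_sub_two_add_norm_add_two_of_mem h
  rw [norm_sub_two_add_norm_add_two (norm_pos_iff.1 (by linarith))] at h1
  linarith [two_lt_add_inv hζ]

theorem eq_of_add_inv_eq_add_inv {ζ η : ℂ} (hζ : 1 < ‖ζ‖) (hη : 1 < ‖η‖)
    (h : ζ + ζ⁻¹ = η + η⁻¹) : ζ = η := by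
  have hζ0 : ζ ≠ 0 := norm_pos_iff.1 (by linarith)
  have hη0 : η ≠ 0 := norm_pos_iff.1 (by linarith)
  have h1 : (ζ - η) * (ζ * η - 1) = 0 := by
    field_simp at h
    linear_combination h
  rcases mul_eq_zero.1 h1 with h2 | h2
  · exact sub_eq_zero.1 h2
  · have h3 : ‖ζ * η‖ = 1 := by rw [sub_eq_zero.1 h2, norm_one]
    rw [norm_mul] at h3
    nlinarith

theorem joukowskiInv_add_inv {ζ : ℂ} (hζ : 1 < ‖ζ‖) : joukowskiInv (ζ + ζ⁻¹) = ζ := by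
  obtain ⟨h1, h2⟩ := joukowskiInv_spec (add_inv_notMem_joukowskiSlit hζ)
  exact eq_of_add_inv_eq_add_inv h1 hζ h2

theorem differentiableAt_joukowskiInv {v : ℂ} (hv : v ∉ joukowskiSlit) :
    DifferentiableAt ℂ joukowskiInv v := by
  have hv0 : v ≠ 0 := fun h => hv (h ▸ zero_mem_joukowskiSlit)
  have hslit := one_sub_four_div_sq_mem_slitPlane hv
  have h1 : DifferentiableAt ℂ (fun v : ℂ => 1 - 4 / v ^ 2) v := by
    fun_prop (disch := exact pow_ne_zero 2 hv0)
  exact (differentiableAt_id.div_const 2).mul ((h1.cpow_const hslit).const_add 1)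

/-! ### The explicit lemniscatic map of a star -/

/-- The parameters of a star `{z | (z - t₁) ^ n / M - ρ - ρ⁻¹ ∈ [-2, 2]}` with centre `t₁` and of
its lemniscatic domain `{w | M < |(w - t₂) ^ n - M / ρ|}`. -/
structure StarParam where
  n : ℕ
  M : ℝ
  ρ : ℝ
  t₁ : ℂ
  t₂ : ℂ
  n_pos : 0 < n
  M_pos : 0 < M
  ρ_pos : 0 < ρ
  ρ_lt : ρ < 1
  shift : (n = 1 ∧ t₂ = t₁ + M * ρ) ∨ (2 ≤ n ∧ t₂ = t₁)

namespace StarParam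

variable (S : StarParam)

/-- The polynomial map which sends the star onto `[-2, 2]`. -/
noncomputable def v (z : ℂ) : ℂ := (z - S.t₁) ^ S.n / S.M - S.ρ - (S.ρ : ℂ)⁻¹

/-- The star. -/
def star : Set ℂ := {z | S.v z ∈ joukowskiSlit}

/-- The Joukowski coordinate on the complement of the star. -/
noncomputable def zeta (z : ℂ) : ℂ := joukowskiInv (S.v z)

/-- The Joukowski coordinate on the lemniscatic domain. -/
noncomputable def eta (w : ℂ) : ℂ := (w - S.t₂) ^ S.n / S.M - (S.ρ : ℂ)⁻¹

/-- The lemniscatic domain. -/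
def dom : Set ℂ := {w | 1 < ‖S.eta w‖}

/-- The lemniscatic map. -/
noncomputable def outer (z : ℂ) : ℂ :=
  S.t₂ + (z - S.t₁) * (1 + S.ρ / S.zeta z) ^ (-(S.n : ℂ)⁻¹)

/-- The inverse of the lemniscatic map. -/
noncomputable def inner (w : ℂ) : ℂ :=
  S.t₁ + (w - S.t₂) * (1 + S.ρ / S.eta w) ^ ((S.n : ℂ)⁻¹)

theorem M_ne_zero : (S.M : ℂ) ≠ 0 := Complex.ofReal_ne_zero.2 S.M_pos.ne'

theorem ρ_ne_zero : (S.ρ : ℂ) ≠ 0 := Complex.ofReal_ne_zero.2 S.ρ_pos.ne'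

theorem n_ne_zero : S.n ≠ 0 := S.n_pos.ne'

theorem one_add_mem_slitPlane {x : ℂ} (hx : ‖x‖ < 1) : 1 + S.ρ * x ∈ Complex.slitPlane := by
  left
  have h : |((S.ρ : ℂ) * x).re| ≤ S.ρ * ‖x‖ := by
    refine (Complex.abs_re_le_norm _).trans_eq ?_
    rw [norm_mul, Complex.norm_real, Real.norm_of_nonneg S.ρ_pos.le]
  have h2 : S.ρ * ‖x‖ < 1 := by nlinarith [S.ρ_pos, S.ρ_lt, norm_nonneg x]
  rw [Complex.add_re, Complex.one_re]
  linarith [(abs_le.1 h).1]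

theorem one_add_div_mem_slitPlane {ζ : ℂ} (hζ : 1 < ‖ζ‖) : 1 + S.ρ / ζ ∈ Complex.slitPlane := by
  rw [div_eq_mul_inv]
  exact S.one_add_mem_slitPlane (by rw [norm_inv]; exact inv_lt_one_of_one_lt₀ hζ)

theorem isClosed_star : IsClosed S.star := by
  refine isCompact_joukowskiSlit.isClosed.preimage ?_
  unfold v
  fun_prop

theorem isOpen_dom : IsOpen S.dom := by
  refine isOpen_lt continuous_const ?_
  unfold eta
  fun_prop

theorem one_lt_norm_zeta {z : ℂ} (hz : z ∉ S.star) : 1 < ‖S.zeta z‖ := (joukowskiInv_spec hz).1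

theorem zeta_add_inv {z : ℂ} (hz : z ∉ S.star) : S.zeta z + (S.zeta z)⁻¹ = S.v z :=
  (joukowskiInv_spec hz).2

theorem zeta_ne_zero {z : ℂ} (hz : z ∉ S.star) : S.zeta z ≠ 0 :=
  norm_pos_iff.1 (by linarith [S.one_lt_norm_zeta hz])

theorem cpow_neg_inv_pow (x : ℂ) : (x ^ (-(S.n : ℂ)⁻¹)) ^ S.n = x⁻¹ := by
  rw [Complex.cpow_neg, inv_pow, Complex.cpow_nat_inv_pow x S.n_ne_zero]

/-- The factorization `ζ + ζ⁻¹ + ρ + ρ⁻¹ = (ζ + ρ⁻¹) (1 + ρ/ζ)`, whose second factor is cancelled by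
the power in `outer`. -/
theorem outer_sub_pow {z : ℂ} (hz : z ∉ S.star) :
    (S.outer z - S.t₂) ^ S.n = S.M * (S.zeta z + (S.ρ : ℂ)⁻¹) := by
  have h1 := S.zeta_add_inv hz
  have h0 := S.zeta_ne_zero hz
  have hM := S.M_ne_zero
  have hρ := S.ρ_ne_zero
  have h2 := Complex.slitPlane_ne_zero (S.one_add_div_mem_slitPlane (S.one_lt_norm_zeta hz))
  have h3 : S.zeta z + S.ρ ≠ 0 := by
    intro h
    apply h2
    field_simp
    rw [h, mul_zero]
  have h4 : (z - S.t₁) ^ S.n = S.M * (S.zeta z + (S.zeta z)⁻¹ + S.ρ + (S.ρ : ℂ)⁻¹) := by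
    rw [h1, v]
    field_simp
    ring
  rw [outer, add_sub_cancel_left, mul_pow, S.cpow_neg_inv_pow, h4]
  field_simp
  ring

theorem eta_outer {z : ℂ} (hz : z ∉ S.star) : S.eta (S.outer z) = S.zeta z := by
  have hM := S.M_ne_zero
  rw [eta, S.outer_sub_pow hz, mul_div_cancel_left₀ _ hM, add_sub_cancel_right]

theorem outer_mem_dom {z : ℂ} (hz : z ∉ S.star) : S.outer z ∈ S.dom := by
  change 1 < ‖_‖
  rw [S.eta_outer hz]
  exact S.one_lt_norm_zeta hz

theorem inner_outer {z : ℂ} (hz : z ∉ S.star) : S.inner (S.outer z) = z := by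
  have h2 := Complex.slitPlane_ne_zero (S.one_add_div_mem_slitPlane (S.one_lt_norm_zeta hz))
  rw [inner, S.eta_outer hz, outer, add_sub_cancel_left, mul_assoc, ← Complex.cpow_add _ _ h2,
    neg_add_cancel, Complex.cpow_zero]
  ring

theorem eta_ne_zero {w : ℂ} (hw : w ∈ S.dom) : S.eta w ≠ 0 :=
  norm_pos_iff.1 (one_pos.trans hw)

theorem sub_pow_eq_eta (w : ℂ) : (w - S.t₂) ^ S.n = S.M * (S.eta w + (S.ρ : ℂ)⁻¹) := by
  have hM := S.M_ne_zero
  rw [eta]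
  field_simp
  ring

theorem inner_sub_pow {w : ℂ} (hw : w ∈ S.dom) :
    (S.inner w - S.t₁) ^ S.n = S.M * (S.eta w + (S.eta w)⁻¹ + S.ρ + (S.ρ : ℂ)⁻¹) := by
  have h0 := S.eta_ne_zero hw
  have hρ := S.ρ_ne_zero
  rw [inner, add_sub_cancel_left, mul_pow, Complex.cpow_nat_inv_pow _ S.n_ne_zero,
    S.sub_pow_eq_eta w]
  field_simp
  ring

theorem v_inner {w : ℂ} (hw : w ∈ S.dom) : S.v (S.inner w) = S.eta w + (S.eta w)⁻¹ := by
  rw [v, S.inner_sub_pow hw, mul_div_cancel_left₀ _ S.M_ne_zero]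
  ring

theorem inner_notMem_star {w : ℂ} (hw : w ∈ S.dom) : S.inner w ∉ S.star := by
  intro h
  have h : S.v (S.inner w) ∈ joukowskiSlit := h
  rw [S.v_inner hw] at h
  exact add_inv_notMem_joukowskiSlit hw h

theorem zeta_inner {w : ℂ} (hw : w ∈ S.dom) : S.zeta (S.inner w) = S.eta w := by
  rw [zeta, S.v_inner hw, joukowskiInv_add_inv hw]

theorem outer_inner {w : ℂ} (hw : w ∈ S.dom) : S.outer (S.inner w) = w := by
  have h2 := Complex.slitPlane_ne_zero (S.one_add_div_mem_slitPlane hw)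
  rw [outer, S.zeta_inner hw, inner, add_sub_cancel_left, mul_assoc, ← Complex.cpow_add _ _ h2,
    add_neg_cancel, Complex.cpow_zero]
  ring

theorem bijOn_outer : Set.BijOn S.outer S.starᶜ S.dom :=
  Set.InvOn.bijOn ⟨fun _ hz => S.inner_outer hz, fun _ hw => S.outer_inner hw⟩
    (fun _ hz => S.outer_mem_dom hz) (fun _ hw => S.inner_notMem_star hw)

theorem differentiableAt_zeta {z : ℂ} (hz : z ∉ S.star) : DifferentiableAt ℂ S.zeta z := by
  refine DifferentiableAt.comp z (differentiableAt_joukowskiInv hz) ?_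
  unfold v
  fun_prop

theorem differentiableAt_outer {z : ℂ} (hz : z ∉ S.star) : DifferentiableAt ℂ S.outer z := by
  have h1 := S.differentiableAt_zeta hz
  unfold outer
  refine DifferentiableAt.const_add _ (DifferentiableAt.mul (by fun_prop) ?_)
  exact DifferentiableAt.cpow_const
    (DifferentiableAt.const_add _ ((differentiableAt_const _).div h1 (S.zeta_ne_zero hz)))
    (S.one_add_div_mem_slitPlane (S.one_lt_norm_zeta hz))

theorem hasDerivAt_inner {w : ℂ} (hw : w ∈ S.dom) :
    HasDerivAt S.inner ((1 - (S.eta w)⁻¹ ^ 2) *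
      (1 + S.ρ / S.eta w) ^ ((S.n : ℂ)⁻¹ - 1)) w := by
  have h0 := S.eta_ne_zero hw
  have hρ := S.ρ_ne_zero
  have hM := S.M_ne_zero
  have hn : (S.n : ℂ) ≠ 0 := Nat.cast_ne_zero.2 S.n_ne_zero
  have hslit := S.one_add_div_mem_slitPlane hw
  have h2 := Complex.slitPlane_ne_zero hslit
  have hη : HasDerivAt S.eta (S.n * (w - S.t₂) ^ (S.n - 1) * 1 / S.M) w :=
    ((((hasDerivAt_id w).sub_const S.t₂).pow S.n).div_const _).sub_const _
  have hd := (((hasDerivAt_id w).sub_const S.t₂).mul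
    ((((hasDerivAt_const w (S.ρ : ℂ)).div hη h0).const_add 1).cpow_const
      (c := (S.n : ℂ)⁻¹) hslit)).const_add S.t₁
  refine hd.congr_deriv ?_
  have hsplit : (1 + S.ρ / S.eta w) ^ ((S.n : ℂ)⁻¹) =
      (1 + S.ρ / S.eta w) * (1 + S.ρ / S.eta w) ^ ((S.n : ℂ)⁻¹ - 1) := by
    rw [Complex.cpow_sub _ _ h2, Complex.cpow_one, mul_div_cancel₀ _ h2]
  -- The factor `w - t₂` of `inner` meets the power `n - 1` from the derivative of `eta`; their
  -- product is affine in `eta`, so the derivative depends on `eta` alone.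
  have hpow : (w - S.t₂) * (w - S.t₂) ^ (S.n - 1) = S.M * (S.eta w + (S.ρ : ℂ)⁻¹) := by
    rw [← S.sub_pow_eq_eta, mul_pow_sub_one S.n_ne_zero]
  simp only [id, Pi.div_apply]
  rw [hsplit]
  generalize (1 + S.ρ / S.eta w) ^ ((S.n : ℂ)⁻¹ - 1) = y
  field_simp
  field_simp at hpow
  linear_combination (-y * S.n) * hpow

/-! ### Behaviour at infinity -/

theorem tendsto_sub_pow_div_sub (t c : ℂ) :
    Tendsto (fun z => (z - t) ^ S.n / S.M - c) (cobounded ℂ) (cobounded ℂ) := by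
  refine (tendsto_sub_const_cobounded c).comp ?_
  simp only [div_eq_mul_inv]
  exact (tendsto_mul_right_cobounded (inv_ne_zero S.M_ne_zero)).comp
    ((tendsto_pow_cobounded_cobounded S.n_ne_zero).comp (tendsto_sub_const_cobounded t))

theorem tendsto_v : Tendsto S.v (cobounded ℂ) (cobounded ℂ) :=
  (S.tendsto_sub_pow_div_sub S.t₁ (S.ρ + (S.ρ : ℂ)⁻¹)).congr fun z => by rw [v, sub_sub]

theorem tendsto_eta : Tendsto S.eta (cobounded ℂ) (cobounded ℂ) :=
  S.tendsto_sub_pow_div_sub S.t₂ (S.ρ : ℂ)⁻¹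

theorem eventually_notMem_star : ∀ᶠ z in cobounded ℂ, z ∉ S.star :=
  S.tendsto_v.eventually (isBounded_def.1 isCompact_joukowskiSlit.isBounded)

theorem norm_v_sub_zeta_lt {z : ℂ} (hz : z ∉ S.star) : ‖S.v z - S.zeta z‖ < 1 := by
  rw [← S.zeta_add_inv hz, add_sub_cancel_left, norm_inv]
  exact inv_lt_one_of_one_lt₀ (S.one_lt_norm_zeta hz)

/-- `v - ζ = ζ⁻¹` has modulus below `1`, so `|z - t₁| ^ n` is at most a constant times `|ζ|`. -/
theorem isBigO_inv_zeta : (fun z => (S.zeta z)⁻¹) =O[cobounded ℂ] fun z => (z⁻¹) ^ S.n := by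
  refine IsBigO.of_bound (2 ^ S.n * (S.M * (2 + S.ρ + S.ρ⁻¹))) ?_
  filter_upwards [S.eventually_notMem_star, eventually_lt_norm_cobounded (2 * ‖S.t₁‖),
    eventually_lt_norm_cobounded 0] with z hz hz1 hz0
  have hζ := S.one_lt_norm_zeta hz
  have hρ : 0 < S.ρ⁻¹ := inv_pos.2 S.ρ_pos
  have h1 : ‖z‖ ≤ 2 * ‖z - S.t₁‖ := by linarith [norm_sub_norm_le z S.t₁]
  have h2 : (z - S.t₁) ^ S.n = S.M * (S.v z - S.zeta z + S.zeta z + S.ρ + (S.ρ : ℂ)⁻¹) := by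
    have := S.M_ne_zero
    rw [v]
    field_simp
    ring
  have h3 : ‖(z - S.t₁)‖ ^ S.n ≤ S.M * ((2 + S.ρ + S.ρ⁻¹) * ‖S.zeta z‖) := by
    rw [← norm_pow, h2, norm_mul, Complex.norm_real, Real.norm_of_nonneg S.M_pos.le]
    refine mul_le_mul_of_nonneg_left ?_ S.M_pos.le
    refine (norm_add₄_le).trans ?_
    rw [norm_inv, Complex.norm_real, Real.norm_of_nonneg S.ρ_pos.le]
    nlinarith [S.norm_v_sub_zeta_lt hz, S.ρ_pos]
  have h4 : ‖z‖ ^ S.n ≤ 2 ^ S.n * (S.M * (2 + S.ρ + S.ρ⁻¹)) * ‖S.zeta z‖ :=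
    calc ‖z‖ ^ S.n ≤ (2 * ‖z - S.t₁‖) ^ S.n := by gcongr
      _ = 2 ^ S.n * ‖z - S.t₁‖ ^ S.n := mul_pow _ _ _
      _ ≤ 2 ^ S.n * (S.M * ((2 + S.ρ + S.ρ⁻¹) * ‖S.zeta z‖)) := by gcongr
      _ = _ := by ring
  rw [norm_inv, norm_pow, norm_inv, inv_pow, ← div_eq_mul_inv, inv_eq_one_div,
    div_le_div_iff₀ (by linarith) (by positivity), one_mul]
  exact h4

theorem tendsto_inv_zeta : Tendsto (fun z => (S.zeta z)⁻¹) (cobounded ℂ) (nhds 0) := by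
  refine S.isBigO_inv_zeta.trans_tendsto ?_
  simpa [zero_pow S.n_ne_zero] using (tendsto_inv₀_cobounded (α := ℂ)).pow S.n

/-- For `n = 1` the shift `t₂ = t₁ + M ρ` cancels the constant term, leaving `-M ζ⁻¹`. For `n ≥ 2`
the correction factor is `1 + O(z ^ (-n))`, so the error is `O(z ^ (1 - n))` with no shift. -/
theorem isBigO_outer : (fun z => S.outer z - z) =O[cobounded ℂ] fun z => z⁻¹ := by
  rcases S.shift with ⟨hn, ht⟩ | ⟨hn, ht⟩
  · have h1 : (fun z => S.outer z - z) =ᶠ[cobounded ℂ] fun z => -S.M * (S.zeta z)⁻¹ := by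
      filter_upwards [S.eventually_notMem_star] with z hz
      have h2 := S.outer_sub_pow hz
      have h3 := S.zeta_add_inv hz
      have hM := S.M_ne_zero
      rw [hn, pow_one] at h2
      rw [v, hn, pow_one] at h3
      have h4 : z = S.M * (S.zeta z + (S.zeta z)⁻¹ + S.ρ + (S.ρ : ℂ)⁻¹) + S.t₁ := by
        rw [h3]
        field_simp
        ring
      linear_combination h2 - h4 + ht
    refine h1.trans_isBigO ((S.isBigO_inv_zeta.const_mul_left _).trans_eventuallyEq ?_)
    filter_upwards with z
    rw [hn, pow_one]
  · have hg : DifferentiableAt ℂ (fun x : ℂ => (1 + S.ρ * x) ^ (-(S.n : ℂ)⁻¹)) 0 := by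
      refine DifferentiableAt.cpow_const (by fun_prop) ?_
      exact S.one_add_mem_slitPlane (by simp)
    have h1 := hg.isBigO_sub.comp_tendsto S.tendsto_inv_zeta
    have h2 : (fun z => S.outer z - z) = fun z => (z - S.t₁) *
        ((1 + S.ρ * (S.zeta z)⁻¹) ^ (-(S.n : ℂ)⁻¹) - (1 + S.ρ * 0) ^ (-(S.n : ℂ)⁻¹)) := by
      ext z
      rw [outer, ht, mul_zero, add_zero, Complex.one_cpow, div_eq_mul_inv]
      ring
    rw [h2]
    have h3 : (fun z : ℂ => z - S.t₁) =O[cobounded ℂ] fun z => z := by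
      refine IsBigO.of_bound 2 ?_
      filter_upwards [eventually_lt_norm_cobounded ‖S.t₁‖] with z hz
      linarith [norm_sub_le z S.t₁]
    have h4 : (fun z => (S.zeta z)⁻¹ - 0) =O[cobounded ℂ] fun z => (z⁻¹) ^ S.n := by
      simpa using S.isBigO_inv_zeta
    refine (h3.mul (h1.trans h4)).trans (IsBigO.of_bound 1 ?_)
    filter_upwards [eventually_lt_norm_cobounded 1] with z hz
    have hz0 : z ≠ 0 := norm_pos_iff.1 (by linarith)
    obtain ⟨m, hm⟩ := Nat.exists_eq_add_of_le hn
    rw [hm, show z * z⁻¹ ^ (2 + m) = z⁻¹ * z⁻¹ ^ m by rw [pow_add]; field_simp, one_mul, norm_mul,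
      norm_pow]
    refine mul_le_of_le_one_right (norm_nonneg _) (pow_le_one₀ (norm_nonneg _) ?_)
    rw [norm_inv]
    exact inv_le_one_of_one_le₀ hz.le

/-! ### The complement of the star is connected -/

/-- The complement is the union of two overlapping connected sets: `A`, where `v` avoids the ray
`[-2, ∞)`, which is star-shaped about `t₁` because `v t₁ = -κ < -2`; and `B`, the exterior of a
disc, which is an exponential image of a half-plane. -/
theorem isPreconnected_compl_star : IsPreconnected S.starᶜ := by
  have hM := S.M_pos
  have hM0 := S.M_ne_zero
  have hρ : 2 < S.ρ + S.ρ⁻¹ := by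
    have := two_lt_add_inv ((one_lt_inv₀ S.ρ_pos).2 S.ρ_lt)
    rw [inv_inv] at this
    linarith
  set κ : ℝ := S.ρ + S.ρ⁻¹ with hκ
  have hv : ∀ z, S.v z = (z - S.t₁) ^ S.n / S.M - κ := fun z => by
    rw [v, hκ]
    push_cast
    ring
  set A : Set ℂ := {z | ∀ x : ℝ, -2 ≤ x → S.v z ≠ x} with hA
  set B : Set ℂ := {z | S.M * (2 + κ) < ‖z - S.t₁‖ ^ S.n} with hB
  have htA : S.t₁ ∈ A := by
    intro x hx h
    rw [hv, sub_self, zero_pow S.n_ne_zero, zero_div, zero_sub, ← Complex.ofReal_neg,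
      Complex.ofReal_inj] at h
    linarith
  have hAstar : StarConvex ℝ S.t₁ A := by
    rw [starConvex_iff_forall_pos htA]
    intro y hy a b ha hb hab x hx h
    have h1 : a • S.t₁ + b • y - S.t₁ = (b : ℂ) * (y - S.t₁) := by
      rw [Complex.real_smul, Complex.real_smul, show a = 1 - b by linarith]
      push_cast
      ring
    have hb0 : (b : ℂ) ≠ 0 := Complex.ofReal_ne_zero.2 hb.ne'
    rw [hv, h1, mul_pow] at h
    refine hy ((x + κ) / b ^ S.n - κ) ?_ ?_
    · have : x + κ ≤ (x + κ) / b ^ S.n :=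
        le_div_self (by linarith) (by positivity) (pow_le_one₀ hb.le (by linarith))
      linarith
    · rw [hv]
      push_cast
      rw [← h]
      field_simp
      ring
  have hK : 0 < S.M * (2 + κ) := by positivity
  have hBconn : IsPreconnected B := by
    have h1 : IsPreconnected {s : ℂ | Real.log (S.M * (2 + κ)) / S.n < s.re} :=
      (convex_halfSpace_re_gt _).isPreconnected
    have hexp : ∀ s : ℂ, Real.log (S.M * (2 + κ)) / S.n < s.re ↔
        S.M * (2 + κ) < ‖Complex.exp s‖ ^ S.n := by
      intro s
      rw [Complex.norm_exp, ← Real.exp_nat_mul, div_lt_iff₀ (Nat.cast_pos.2 S.n_pos), mul_comm s.re,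
        Real.log_lt_iff_lt_exp hK]
    have h2 : B = (fun s => S.t₁ + Complex.exp s) ''
        {s : ℂ | Real.log (S.M * (2 + κ)) / S.n < s.re} := by
      ext z
      constructor
      · intro hz
        have hz' : S.M * (2 + κ) < ‖z - S.t₁‖ ^ S.n := hz
        have hz0 : z - S.t₁ ≠ 0 := by
          intro h0
          rw [h0, norm_zero, zero_pow S.n_ne_zero] at hz'
          linarith
        refine ⟨Complex.log (z - S.t₁), (hexp _).2 ?_, ?_⟩
        · rwa [Complex.exp_log hz0]
        · simp only [Complex.exp_log hz0]
          ring
      · rintro ⟨s, hs, rfl⟩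
        have := (hexp s).1 hs
        change _ < ‖S.t₁ + Complex.exp s - S.t₁‖ ^ S.n
        rwa [add_sub_cancel_left]
    rw [h2]
    exact h1.image _ (by fun_prop)
  have hpow : ∀ (z : ℂ) (x : ℝ), S.v z = x → ‖z - S.t₁‖ ^ S.n = S.M * |x + κ| := by
    intro z x h
    rw [hv, sub_eq_iff_eq_add, div_eq_iff hM0] at h
    rw [← norm_pow, h, ← Complex.ofReal_add, ← Complex.ofReal_mul, Complex.norm_real,
      Real.norm_eq_abs, abs_mul, abs_of_pos hM, mul_comm]
  have hunion : S.starᶜ = A ∪ B := by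
    ext z
    constructor
    · intro hz
      by_contra h
      have hzA : z ∉ A := fun h' => h (Or.inl h')
      have hzB : ¬ S.M * (2 + κ) < ‖z - S.t₁‖ ^ S.n := fun h' => h (Or.inr h')
      have : ∃ x : ℝ, -2 ≤ x ∧ S.v z = x := by
        by_contra h2
        exact hzA fun x hx hx' => h2 ⟨x, hx, hx'⟩
      obtain ⟨x, hx, hx'⟩ := this
      refine hz ⟨x, ⟨hx, ?_⟩, hx'.symm⟩
      by_contra hx2
      apply hzB
      rw [hpow z x hx', abs_of_pos (by linarith)]
      gcongr
      linarith
    · rintro (hz | hz) ⟨x, ⟨hx1, hx2⟩, hx⟩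
      · exact hz x hx1 hx.symm
      · have hz : S.M * (2 + κ) < ‖z - S.t₁‖ ^ S.n := hz
        rw [hpow z x hx.symm, abs_of_pos (by linarith)] at hz
        nlinarith
  obtain ⟨y, hyA, hyB⟩ : ∃ y, y ∈ A ∧ y ∈ B := by
    -- A negative value of `(y - t₁) ^ n` keeps `v` off the ray; the constant `3 > 2` places the
    -- point beyond the disc.
    obtain ⟨u, hu⟩ := IsAlgClosed.exists_pow_nat_eq (((-(S.M * (3 + κ)) : ℝ)) : ℂ) S.n_pos
    refine ⟨S.t₁ + u, ?_, ?_⟩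
    · intro x hx h
      rw [hv, add_sub_cancel_left, hu, ← Complex.ofReal_div, ← Complex.ofReal_sub,
        Complex.ofReal_inj, neg_div, mul_div_cancel_left₀ _ hM.ne'] at h
      linarith
    · change _ < ‖_‖ ^ _
      rw [add_sub_cancel_left, ← norm_pow, hu, Complex.norm_real, norm_neg,
        Real.norm_of_nonneg (by positivity)]
      gcongr
      norm_num
  rw [hunion]
  exact (hAstar.isPathConnected htA).isConnected.isPreconnected.union y hyA hyB hBconn

end StarParam

/-! ### Uniqueness of the lemniscatic map of a star -/

theorem tendsto_sub_div_of_isBigO_inv {f : ℂ → ℂ}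
    (h : (fun z => f z - z) =O[cobounded ℂ] fun z => z⁻¹) (t : ℂ) :
    Tendsto (fun z => (f z - t) * z⁻¹) (cobounded ℂ) (nhds 1) := by
  have h0 : Tendsto (fun z => f z - z) (cobounded ℂ) (nhds 0) :=
    h.trans_tendsto tendsto_inv₀_cobounded
  have h1 : Tendsto (fun z => ((f z - z) - t) * z⁻¹ + 1) (cobounded ℂ) (nhds ((0 - t) * 0 + 1)) :=
    ((h0.sub_const t).mul tendsto_inv₀_cobounded).add_const 1
  rw [mul_zero, zero_add] at h1
  refine h1.congr' ?_
  filter_upwards [eventually_ne_cobounded (0 : ℂ)] with z hz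
  field_simp
  ring

theorem exists_mem_eventually_nhds_of_cobounded {p : ℂ → Prop} (h : ∀ᶠ z in cobounded ℂ, p z) :
    ∃ z, ∀ᶠ y in nhds z, p y := by
  obtain ⟨R, hR⟩ := eventually_cobounded_iff_exists_norm.1 h
  obtain ⟨z, hz⟩ := (eventually_lt_norm_cobounded R).exists
  exact ⟨z, mem_of_superset ((isOpen_lt continuous_const continuous_norm).mem_nhds hz) hR⟩

namespace StarParam

variable (S : StarParam)

theorem tendsto_eta_mul_inv_pow {f : ℂ → ℂ}
    (h : (fun z => f z - z) =O[cobounded ℂ] fun z => z⁻¹) :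
    Tendsto (fun z => S.eta (f z) * z⁻¹ ^ S.n) (cobounded ℂ) (nhds (S.M : ℂ)⁻¹) := by
  have h1 : Tendsto (fun z => ((f z - S.t₂) * z⁻¹) ^ S.n / S.M - (S.ρ : ℂ)⁻¹ * z⁻¹ ^ S.n)
      (cobounded ℂ) (nhds (1 ^ S.n / S.M - (S.ρ : ℂ)⁻¹ * 0 ^ S.n)) :=
    (((tendsto_sub_div_of_isBigO_inv h S.t₂).pow S.n).div_const _).sub
      ((tendsto_inv₀_cobounded.pow S.n).const_mul _)
  rw [one_pow, zero_pow S.n_ne_zero, mul_zero, sub_zero, one_div] at h1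
  refine h1.congr fun z => ?_
  rw [eta, mul_pow]
  ring

theorem continuousOn_invFunOn_of_isLemniscaticMap {N : ℕ} {a : Fin N → ℂ} {m : Fin N → ℝ} {μ : ℝ}
    {Φ : ℂ → ℂ} (h : IsLemniscaticMap S.star a m μ Φ) :
    ContinuousOn (Function.invFunOn Φ S.starᶜ) (lemniscaticDomain a m μ) := by
  rw [← h.bijOn.image_eq]
  refine continuousOn_invFunOn_of_differentiableOn S.isClosed_star.isOpen_compl
    S.isPreconnected_compl_star h.differentiableOn h.bijOn.injOn ?_
  obtain ⟨R, hR⟩ := eventually_cobounded_iff_exists_norm.1 S.eventually_notMem_star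
  obtain ⟨x, hx⟩ := (eventually_lt_norm_cobounded R).exists
  obtain ⟨y, hy, hxy⟩ := ((eventually_lt_norm_cobounded R).and (eventually_ne_cobounded x)).exists
  exact ⟨x, hR x hx, y, hR y hy, hxy.symm⟩

/-- `x + x⁻¹` increases for `x ≥ 1`. Hence `|ζ| ≥ u` forces a closed condition on `v z` that fails
on the star, which yields the compact sets for the maximum principle. -/
theorem lt_of_norm_zeta {z : ℂ} (hz : z ∉ S.star) {u : ℝ} (hu : 1 < u)
    (h : ‖S.v z - 2‖ + ‖S.v z + 2‖ < 2 * (u + u⁻¹)) : ‖S.zeta z‖ < u := by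
  rw [← S.zeta_add_inv hz, norm_sub_two_add_norm_add_two (S.zeta_ne_zero hz)] at h
  have hζ := S.one_lt_norm_zeta hz
  set x := ‖S.zeta z‖
  by_contra hle
  have hle := not_lt.1 hle
  have h1 : x + x⁻¹ - (u + u⁻¹) = (x - u) * (x * u - 1) / (x * u) := by
    field_simp
    ring
  have h2 : 0 ≤ (x - u) * (x * u - 1) / (x * u) :=
    div_nonneg (mul_nonneg (by linarith) (by nlinarith)) (by positivity)
  linarith

section Uniqueness

variable {S} {N : ℕ} {a : Fin N → ℂ} {m : Fin N → ℝ} {μ : ℝ} {Φ : ℂ → ℂ}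

/-- Both functions are asymptotic to `z ^ n / M`, so either quotient tends to `1` at infinity. The
level `μ` is still unknown, so the quotient is chosen to have boundary limits at most `1`: the
denominator has modulus above `1`, and the numerator has modulus at most `1` in the limit. -/
theorem zeta_eq_eta_of_isLemniscaticMap (h : IsLemniscaticMap S.star a m μ Φ)
    (hU : ∀ w, absU a m w ^ S.n = S.M * ‖S.eta w‖) {z : ℂ} (hz : z ∉ S.star) :
    S.zeta z = S.eta (Φ z) := by
  have hM := S.M_pos
  have hopen := S.isClosed_star.isOpen_compl
  have hd : ∀ z, z ∉ S.star → DifferentiableAt ℂ Φ z := fun z hz =>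
    h.differentiableOn.differentiableAt (hopen.mem_nhds hz)
  have hdeta : ∀ z, z ∉ S.star → DifferentiableAt ℂ (fun z => S.eta (Φ z)) z := fun z hz => by
    have := hd z hz
    unfold eta
    fun_prop
  have hηpos : ∀ z, z ∉ S.star → μ ^ S.n < S.M * ‖S.eta (Φ z)‖ := fun z hz => by
    rw [← hU]
    exact pow_lt_pow_left₀ (h.bijOn.mapsTo hz) h.level_pos.le S.n_ne_zero
  have hη0 : ∀ z, z ∉ S.star → S.eta (Φ z) ≠ 0 := fun z hz h0 => by
    have := hηpos z hz
    rw [h0, norm_zero, mul_zero] at this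
    exact absurd this (not_lt.2 (pow_pos h.level_pos _).le)
  have hζlim : Tendsto (fun z => S.zeta z * z⁻¹ ^ S.n) (cobounded ℂ) (nhds (S.M : ℂ)⁻¹) :=
    (S.tendsto_eta_mul_inv_pow S.isBigO_outer).congr'
      (S.eventually_notMem_star.mono fun z hz => by rw [S.eta_outer hz])
  have hηlim := S.tendsto_eta_mul_inv_pow h.at_infinity
  have hM0 : (S.M : ℂ)⁻¹ ≠ 0 := inv_ne_zero S.M_ne_zero
  have hcancel : ∀ f g : ℂ → ℂ, Tendsto (fun z => f z * z⁻¹ ^ S.n) (cobounded ℂ) (nhds (S.M : ℂ)⁻¹) →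
      Tendsto (fun z => g z * z⁻¹ ^ S.n) (cobounded ℂ) (nhds (S.M : ℂ)⁻¹) →
      Tendsto (fun z => f z / g z) (cobounded ℂ) (nhds 1) := by
    intro f g hf hg
    have := hf.div hg hM0
    rw [div_self hM0] at this
    refine this.congr' ?_
    filter_upwards [eventually_ne_cobounded (0 : ℂ)] with z hz
    exact mul_div_mul_right _ _ (pow_ne_zero _ (inv_ne_zero hz))
  rcases le_total S.M (μ ^ S.n) with hc | hc
  · have hlim := hcancel _ _ hζlim hηlim
    have key : S.zeta z / S.eta (Φ z) = 1 := by
      refine eqOn_one_of_tendsto_one_of_norm_lt hopen S.isPreconnected_compl_star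
        S.eventually_notMem_star (fun z hz => ((S.differentiableAt_zeta hz).div (hdeta z hz)
          (hη0 z hz)).differentiableWithinAt) hlim ?_ z hz
      intro u hu
      have hlt : ∀ᶠ z in cobounded ℂ, ‖S.zeta z / S.eta (Φ z)‖ < u := by
        have := hlim.norm
        rw [norm_one] at this
        exact this.eventually (gt_mem_nhds hu)
      obtain ⟨R, hR⟩ := eventually_cobounded_iff_exists_norm.1 hlt
      refine ⟨Metric.closedBall 0 R ∩ {z | 2 * (u + u⁻¹) ≤ ‖S.v z - 2‖ + ‖S.v z + 2‖}, ?_,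
        (isCompact_closedBall 0 R).inter_right (isClosed_le continuous_const ?_), ?_⟩
      · rintro z ⟨-, hz⟩ hzs
        have hz : 2 * (u + u⁻¹) ≤ ‖S.v z - 2‖ + ‖S.v z + 2‖ := hz
        rw [norm_sub_two_add_norm_add_two_of_mem hzs] at hz
        linarith [two_lt_add_inv hu]
      · unfold v
        fun_prop
      · intro z hz hzK
        by_cases hzR : R < ‖z‖
        · exact hR z hzR
        · have h1 := S.lt_of_norm_zeta hz hu (not_le.1 fun h' =>
            hzK ⟨mem_closedBall_zero_iff.2 (not_lt.1 hzR), h'⟩)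
          have h2 : 1 < ‖S.eta (Φ z)‖ := by
            have := hηpos z hz
            by_contra h'
            nlinarith
          rw [Pi.div_apply, norm_div]
          exact (div_le_self (norm_nonneg _) h2.le).trans_lt h1
    exact (div_eq_one_iff_eq (hη0 z hz)).1 key
  · have hlim := hcancel _ _ hηlim hζlim
    have key : S.eta (Φ z) / S.zeta z = 1 := by
      refine eqOn_one_of_tendsto_one_of_norm_lt hopen S.isPreconnected_compl_star
        S.eventually_notMem_star (fun z hz => ((hdeta z hz).div (S.differentiableAt_zeta hz)
          (S.zeta_ne_zero hz)).differentiableWithinAt) hlim ?_ z hz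
      intro u hu
      have hlt : ∀ᶠ z in cobounded ℂ, ‖S.eta (Φ z) / S.zeta z‖ < u := by
        have := hlim.norm
        rw [norm_one] at this
        exact this.eventually (gt_mem_nhds hu)
      obtain ⟨R, hR⟩ := eventually_cobounded_iff_exists_norm.1 (hlt.and S.eventually_notMem_star)
      obtain ⟨R', hR'⟩ := (exists_norm_lt_of_isBigO_inv (S.eventually_notMem_star.mono hd)
        h.at_infinity) R
      -- Here `μ ^ n ≤ M`, so for `u > 1` the region `u ≤ |η|` lies inside the lemniscatic domain,
      -- and its bounded part has compact preimage under `Φ`.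
      have hsub : Metric.closedBall 0 R' ∩ {w | u ≤ ‖S.eta w‖} ⊆ lemniscaticDomain a m μ := by
        rintro w ⟨-, hw⟩
        have hw : u ≤ ‖S.eta w‖ := hw
        refine lt_of_pow_lt_pow_left₀ S.n (Finset.prod_nonneg fun j _ =>
          Real.rpow_nonneg (norm_nonneg _) _) ?_
        change μ ^ S.n < absU a m w ^ S.n
        rw [hU]
        nlinarith
      refine ⟨Function.invFunOn Φ S.starᶜ '' (Metric.closedBall 0 R' ∩ {w | u ≤ ‖S.eta w‖}), ?_,
        ?_, ?_⟩
      · rintro _ ⟨w, hw, rfl⟩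
        exact Function.invFunOn_mem (h.bijOn.surjOn (hsub hw))
      · refine ((isCompact_closedBall 0 R').inter_right (isClosed_le continuous_const ?_)).image_of_continuousOn
          ((S.continuousOn_invFunOn_of_isLemniscaticMap h).mono hsub)
        unfold eta
        fun_prop
      · intro z hz hzK
        by_cases hzR : R' < ‖Φ z‖
        · obtain ⟨z', hz', hzz'⟩ := hR' _ hzR
          rw [← h.bijOn.injOn (hR z' hz').2 hz hzz']
          exact (hR z' hz').1
        · have h1 : ‖S.eta (Φ z)‖ < u := by
            refine not_le.1 fun h' => hzK ⟨Φ z, ⟨mem_closedBall_zero_iff.2 (not_lt.1 hzR), h'⟩, ?_⟩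
            exact h.bijOn.injOn.leftInvOn_invFunOn hz
          rw [Pi.div_apply, norm_div]
          exact (div_le_self (norm_nonneg _) (S.one_lt_norm_zeta hz).le).trans_lt h1
    exact ((div_eq_one_iff_eq (S.zeta_ne_zero hz)).1 key).symm

/-- The lemniscatic map of a star is unique. -/
theorem eq_outer_of_isLemniscaticMap (h : IsLemniscaticMap S.star a m μ Φ)
    (hU : ∀ w, absU a m w ^ S.n = S.M * ‖S.eta w‖) {z : ℂ} (hz : z ∉ S.star) :
    Φ z = S.outer z := by
  have hpow : ∀ z, z ∉ S.star → (Φ z - S.t₂) ^ S.n = (S.outer z - S.t₂) ^ S.n := fun z hz => by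
    rw [S.sub_pow_eq_eta, S.outer_sub_pow hz, zeta_eq_eta_of_isLemniscaticMap h hU hz]
  have h1 := tendsto_sub_div_of_isBigO_inv h.at_infinity S.t₂
  have h2 := tendsto_sub_div_of_isBigO_inv S.isBigO_outer S.t₂
  have h3 : Tendsto (fun z => (Φ z - S.t₂) / (S.outer z - S.t₂)) (cobounded ℂ) (nhds 1) := by
    have := h1.div h2 one_ne_zero
    rw [div_one] at this
    refine this.congr' ?_
    filter_upwards [eventually_ne_cobounded (0 : ℂ)] with z hz
    exact mul_div_mul_right _ _ (inv_ne_zero hz)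
  -- The quotient is an `n`-th root of unity tending to `1`; roots of unity are isolated, so it
  -- equals `1` near infinity. The identity theorem does the rest.
  have hfin : ({x : ℂ | x ^ S.n = 1} \ {1}).Finite := by
    refine Set.Finite.sdiff (((nthRootsFinset S.n (1 : ℂ)).finite_toSet).subset fun x hx => ?_)
    exact (mem_nthRootsFinset S.n_pos (1 : ℂ)).2 hx
  have h4 : ∀ᶠ x in nhds (1 : ℂ), x ∉ {x : ℂ | x ^ S.n = 1} \ {1} :=
    hfin.isClosed.isOpen_compl.mem_nhds fun hx => hx.2 rfl
  have hev : ∀ᶠ z in cobounded ℂ, Φ z = S.outer z := by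
    filter_upwards [h3.eventually h4, S.eventually_notMem_star,
      h2.eventually (isOpen_ne.mem_nhds one_ne_zero)] with z hz hzs hz0
    have hne : S.outer z - S.t₂ ≠ 0 := left_ne_zero_of_mul hz0
    have h5 : ((Φ z - S.t₂) / (S.outer z - S.t₂)) ^ S.n = 1 := by
      rw [div_pow, hpow z hzs, div_self (pow_ne_zero _ hne)]
    have h6 : (Φ z - S.t₂) / (S.outer z - S.t₂) = 1 := by
      by_contra h6
      exact hz ⟨h5, h6⟩
    exact sub_left_injective ((div_eq_one_iff_eq hne).1 h6)
  have hopen := S.isClosed_star.isOpen_compl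
  obtain ⟨y, hy⟩ := exists_mem_eventually_nhds_of_cobounded (hev.and S.eventually_notMem_star)
  exact (h.differentiableOn.analyticOnNhd hopen).eqOn_of_preconnected_of_eventuallyEq
    (DifferentiableOn.analyticOnNhd
      (fun z hz => (S.differentiableAt_outer hz).differentiableWithinAt) hopen)
    S.isPreconnected_compl_star hy.self_of_nhds.2 (hy.mono fun z hz => hz.1) hz

end Uniqueness

end StarParam

/-! ### The Faber polynomials of an interval -/

/-- The Faber polynomials of the interval `[-2, 2]`. -/
noncomputable def intervalFaber (k : ℕ) : ℂ[X] := if k = 0 then 1 else Chebyshev.C ℂ k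

theorem eval_chebyshev_C_add_inv {ξ : ℂ} (hξ : ξ ≠ 0) (k : ℕ) :
    (Chebyshev.C ℂ k).eval (ξ + ξ⁻¹) = ξ ^ k + ξ⁻¹ ^ k := by
  rw [← Complex.exp_log hξ, ← Complex.exp_neg]
  have := Chebyshev.C_two_mul_complex_cosh (Complex.log ξ) k
  rw [Complex.two_cosh, Complex.two_cosh] at this
  rw [this, ← Complex.exp_nat_mul, ← Complex.exp_nat_mul]
  push_cast
  ring_nf

theorem hasSum_intervalFaber {ξ x : ℂ} (hξ : 1 < ‖ξ‖) (hx : ‖ξ‖ * ‖x‖ < 1) :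
    HasSum (fun k => (intervalFaber k).eval (ξ + ξ⁻¹) * x ^ k)
      ((1 - ξ * x)⁻¹ + (1 - ξ⁻¹ * x)⁻¹ - 1) := by
  have hξ0 : ξ ≠ 0 := norm_pos_iff.1 (by linarith)
  have h1 : ‖ξ * x‖ < 1 := by rwa [norm_mul]
  have h2 : ‖ξ⁻¹ * x‖ < 1 := by
    rw [norm_mul, norm_inv]
    refine (mul_le_mul_of_nonneg_right ?_ (norm_nonneg x)).trans_lt hx
    exact (inv_le_one_of_one_le₀ hξ.le).trans hξ.le
  -- The two geometric series count the term `k = 0` twice, whereas the Faber polynomial of degree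
  -- `0` is `1`.
  have h3 := ((hasSum_geometric_of_norm_lt_one h1).add
    (hasSum_geometric_of_norm_lt_one h2)).sub (hasSum_ite_eq 0 (1 : ℂ))
  refine h3.congr_fun fun k => ?_
  rw [intervalFaber]
  split_ifs with hk
  · simp [hk]
  · rw [eval_chebyshev_C_add_inv hξ0, mul_pow, mul_pow]
    ring

/-! ### Newton interpolation of monomials -/

/-- The coefficients of `x ^ d` with respect to the Newton basis with nodes `γ 0, γ 1, …`. -/
def newtonCoeff (γ : ℕ → ℂ) : ℕ → ℕ → ℂ
  | 0, i => if i = 0 then 1 else 0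
  | d + 1, 0 => γ 0 * newtonCoeff γ d 0
  | d + 1, i + 1 => newtonCoeff γ d i + γ (i + 1) * newtonCoeff γ d (i + 1)

theorem newtonCoeff_eq_zero (γ : ℕ → ℂ) {d : ℕ} : ∀ {i : ℕ}, d < i → newtonCoeff γ d i = 0 := by
  induction d with
  | zero =>
    intro i hi
    simp [newtonCoeff, hi.ne']
  | succ d ih =>
    rintro (_ | i) hi
    · omega
    · rw [newtonCoeff, ih (by omega), ih (by omega)]
      simp

theorem newtonCoeff_self (γ : ℕ → ℂ) (d : ℕ) : newtonCoeff γ d d = 1 := by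
  induction d with
  | zero => simp [newtonCoeff]
  | succ d ih => rw [newtonCoeff, ih, newtonCoeff_eq_zero γ (Nat.lt_succ_self d)]; simp

/-- Induction on `d` by `x * N_i = N_{i+1} + γ i * N_i` for the Newton basis `N_i`. -/
theorem sum_newtonCoeff_mul_nodePoly (γ : ℕ → ℂ) (x : ℂ) {n d : ℕ} (hd : d < n) :
    ∑ i ∈ Finset.range n, newtonCoeff γ d i * nodePoly γ i x = x ^ d := by
  induction d generalizing n with
  | zero =>
    rw [Finset.sum_eq_single_of_mem 0 (Finset.mem_range.2 hd)]
    · simp [newtonCoeff, nodePoly]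
    · intro i _ hi
      simp [newtonCoeff, hi]
  | succ d ih =>
    obtain ⟨n, rfl⟩ := Nat.exists_eq_add_of_le' (show 1 ≤ n by omega)
    have h1 := ih (n := n) (by omega)
    have h2 := ih (n := n + 1) (by omega)
    have h3 : ∑ i ∈ Finset.range (n + 1), newtonCoeff γ (d + 1) i * nodePoly γ i x =
        ∑ i ∈ Finset.range n, newtonCoeff γ d i * nodePoly γ (i + 1) x +
          ∑ i ∈ Finset.range (n + 1), γ i * (newtonCoeff γ d i * nodePoly γ i x) := by
      rw [Finset.sum_range_succ', Finset.sum_range_succ' _ n, ← add_assoc,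
        ← Finset.sum_add_distrib]
      congr 1
      · refine Finset.sum_congr rfl fun i _ => ?_
        rw [newtonCoeff]
        ring
      · rw [newtonCoeff]
        ring
    have h4 : ∑ i ∈ Finset.range n, newtonCoeff γ d i * nodePoly γ (i + 1) x =
        ∑ i ∈ Finset.range (n + 1), (x - γ i) * (newtonCoeff γ d i * nodePoly γ i x) := by
      rw [Finset.sum_range_succ, newtonCoeff_eq_zero γ (show d < n by omega), zero_mul, mul_zero,
        add_zero]
      refine Finset.sum_congr rfl fun i _ => ?_
      rw [nodePoly_succ]
      ring
    rw [h3, h4, ← Finset.sum_add_distrib, pow_succ', ← h2, Finset.mul_sum]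
    refine Finset.sum_congr rfl fun i _ => ?_
    ring

theorem nodePoly_sub (α : ℕ → ℂ) (t w : ℂ) (k : ℕ) :
    nodePoly (fun i => α i - t) k (w - t) = nodePoly α k w :=
  Finset.prod_congr rfl fun i _ => by ring

/-- The complementary factor of `u_{s+1}` in `u_n` uses the last nodes. Reading the nodes backwards
makes these factors a Newton basis, which turns polynomials in `w` over `u_n` into combinations of
`1 / u_{s+1}`. -/
theorem nodePoly_mul_nodePoly_reflect (α : ℕ → ℂ) (w : ℂ) {n s : ℕ} (hs : s < n) :
    nodePoly α (s + 1) w * nodePoly (fun i => α (n - 1 - i)) (n - 1 - s) w = nodePoly α n w := by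
  have h1 : nodePoly α n w = nodePoly α ((s + 1) + (n - 1 - s)) w := by
    rw [show (s + 1) + (n - 1 - s) = n by omega]
  rw [h1, nodePoly_add α (s + 1) (n - 1 - s)]
  congr 1
  rw [nodePoly, nodePoly,
    ← Finset.prod_range_reflect (fun i => w - α (s + 1 + i)) (n - 1 - s)]
  refine Finset.prod_congr rfl fun i hi => ?_
  rw [show s + 1 + (n - 1 - s - 1 - i) = n - 1 - i by have := Finset.mem_range.1 hi; omega]

theorem nodePoly_mul_add {α : ℕ → ℂ} {n : ℕ} (hα : ∀ i, α (i + n) = α i) (w : ℂ) (k s : ℕ) :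
    nodePoly α (n * k + s) w = nodePoly α n w ^ k * nodePoly α s w := by
  induction k with
  | zero => simp
  | succ k ih =>
    rw [show n * (k + 1) + s = n + (n * k + s) by ring, nodePoly_add, pow_succ', mul_assoc, ← ih]
    congr 2
    ext i
    rw [add_comm, hα]

theorem hasSum_of_hasSum_mul_add {n : ℕ} (hn : 0 < n) {f A : ℕ → ℂ}
    (h : ∀ s < n, HasSum (fun k => f (n * k + s)) (A s)) :
    HasSum f (∑ s ∈ Finset.range n, A s) := by
  have h1 : ∀ s ∈ Finset.range n, HasSum (fun m => if m % n = s then f m else 0) (A s) := by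
    intro s hs
    have hs := Finset.mem_range.1 hs
    have hinj : Function.Injective fun k => n * k + s := fun a b hab =>
      Nat.eq_of_mul_eq_mul_left hn (Nat.add_right_cancel hab)
    rw [← hinj.hasSum_iff]
    · refine (h s hs).congr_fun fun k => ?_
      simp [Nat.mod_eq_of_lt hs]
    · intro m hm
      rw [if_neg]
      rintro rfl
      exact hm ⟨m / n, Nat.div_add_mod m n⟩
  refine (hasSum_sum h1).congr_fun fun m => ?_
  rw [Finset.sum_ite_eq, if_pos (Finset.mem_range.2 (Nat.mod_lt m hn))]

/-! ### The generating function and the Faber–Walsh polynomials of a star -/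

namespace StarParam

variable (S : StarParam)

/-- The Taylor coefficients of `(1 + ρ x) ^ (-l / n)`. -/
noncomputable def binomCoeff (l j : ℕ) : ℂ :=
  (j.factorial : ℂ)⁻¹ * iteratedDeriv j (fun x : ℂ => (1 + S.ρ * x) ^ (-(l * (S.n : ℂ)⁻¹))) 0

theorem hasSum_binomCoeff (l : ℕ) {x : ℂ} (hx : ‖x‖ < 1) :
    HasSum (fun j => S.binomCoeff l j * x ^ j) ((1 + S.ρ * x) ^ (-(l * (S.n : ℂ)⁻¹))) := by
  have hd : DifferentiableOn ℂ (fun x : ℂ => (1 + S.ρ * x) ^ (-(l * (S.n : ℂ)⁻¹)))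
      (Metric.ball 0 1) := fun y hy =>
    (((differentiableAt_id.const_mul (S.ρ : ℂ)).const_add 1).cpow_const
      (S.one_add_mem_slitPlane (mem_ball_zero_iff.1 hy))).differentiableWithinAt
  refine (Complex.hasSum_taylorSeries_on_ball hd (mem_ball_zero_iff.2 hx)).congr_fun fun j => ?_
  simp only [binomCoeff, sub_zero, smul_eq_mul]
  ring

theorem binomCoeff_zero (j : ℕ) : S.binomCoeff 0 j = if j = 0 then 1 else 0 := by
  simp only [binomCoeff, Nat.cast_zero, zero_mul, neg_zero, Complex.cpow_zero, iteratedDeriv_const]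
  split_ifs with h <;> simp [h]

/-- The polynomial with values `S.v`. -/
noncomputable def vPoly : ℂ[X] :=
  C (S.M : ℂ)⁻¹ * (X - C S.t₁) ^ S.n - C (S.ρ + (S.ρ : ℂ)⁻¹)

theorem eval_vPoly (z : ℂ) : S.vPoly.eval z = S.v z := by
  simp [vPoly, v]
  ring

/-- The coefficients of `η⁻¹ ^ k` in the expansion of the generating function. -/
noncomputable def genCoeff (l k : ℕ) : ℂ[X] :=
  (X - C S.t₁) ^ l * ∑ ij ∈ Finset.HasAntidiagonal.antidiagonal k,
    (intervalFaber ij.1).comp S.vPoly * C (S.binomCoeff l ij.2)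

theorem genCoeff_zero (k : ℕ) : S.genCoeff 0 k = (intervalFaber k).comp S.vPoly := by
  rw [genCoeff, pow_zero, one_mul, Finset.sum_eq_single_of_mem (k, 0) (by simp)]
  · simp [binomCoeff_zero]
  · rintro ⟨i, j⟩ hij hne
    have : j ≠ 0 := by
      rintro rfl
      apply hne
      simpa using hij
    simp [binomCoeff_zero, this]

/-- The Faber--Walsh polynomials of a star. -/
noncomputable def faberWalsh (α : ℕ → ℂ) (m : ℕ) : ℂ[X] :=
  C ((S.M : ℂ) ^ (m / S.n)) * ∑ l ∈ Finset.range S.n,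
    C (newtonCoeff (fun i => α (S.n - 1 - i) - S.t₂) (S.n - 1 - l) (S.n - 1 - m % S.n)) *
      S.genCoeff l (m / S.n)

/-- The residue `0` calls for the Newton coefficient of index `n - 1` of a power of degree `n - 1 -
l`; it vanishes for `l > 0` and is `1` for `l = 0`, where the binomial series is trivial too. -/
theorem faberWalsh_mul (α : ℕ → ℂ) (k : ℕ) :
    S.faberWalsh α (S.n * k) = C ((S.M : ℂ) ^ k) * (intervalFaber k).comp S.vPoly := by
  rw [faberWalsh, Nat.mul_div_cancel_left _ S.n_pos, Nat.mul_mod_right,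
    Finset.sum_eq_single_of_mem 0 (Finset.mem_range.2 S.n_pos), genCoeff_zero, Nat.sub_zero,
    newtonCoeff_self, C_1, one_mul]
  intro l hl hl0
  rw [newtonCoeff_eq_zero _ (by have := Finset.mem_range.1 hl; omega), C_0, zero_mul]

/-- Cauchy product, in powers of `η⁻¹`, of the Faber series of `[-2, 2]` and the binomial series.
The condition on `|ζ|` and `|η|` gives absolute convergence. -/
theorem hasSum_genCoeff (l : ℕ) {z w : ℂ} (hz : z ∉ S.star) (hw : w ∈ S.dom)
    (hzw : ‖S.zeta z‖ < ‖S.eta w‖) :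
    HasSum (fun k => (S.genCoeff l k).eval z * (S.eta w)⁻¹ ^ k)
      ((z - S.t₁) ^ l * ((S.eta w - (S.eta w)⁻¹) / (S.eta w + (S.eta w)⁻¹ - S.v z) *
        (1 + S.ρ / S.eta w) ^ (-(l * (S.n : ℂ)⁻¹)))) := by
  have hξ := S.one_lt_norm_zeta hz
  have hη0 := S.eta_ne_zero hw
  have hξ0 := S.zeta_ne_zero hz
  have hw' : 1 < ‖S.eta w‖ := hw
  have hx : ‖(S.eta w)⁻¹‖ < 1 := by rw [norm_inv]; exact inv_lt_one_of_one_lt₀ hw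
  have h1 := hasSum_intervalFaber (x := (S.eta w)⁻¹) hξ (by
    rw [norm_inv, ← div_eq_mul_inv]
    exact (div_lt_one (by linarith)).2 hzw)
  have h2 := S.hasSum_binomCoeff l hx
  have h3 := (tsum_mul_tsum_eq_tsum_sum_antidiagonal_of_summable_norm h1.summable.norm
    h2.summable.norm)
  have h4 := (summable_norm_sum_mul_antidiagonal_of_summable_norm h1.summable.norm
    h2.summable.norm).of_norm.hasSum
  rw [← h3, h1.tsum_eq, h2.tsum_eq] at h4
  have h5 : (1 - S.zeta z * (S.eta w)⁻¹)⁻¹ + (1 - (S.zeta z)⁻¹ * (S.eta w)⁻¹)⁻¹ - 1 =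
      (S.eta w - (S.eta w)⁻¹) / (S.eta w + (S.eta w)⁻¹ - S.v z) := by
    rw [← S.zeta_add_inv hz]
    have hne1 : S.eta w - S.zeta z ≠ 0 := by
      intro h
      rw [sub_eq_zero.1 h] at hzw
      exact lt_irrefl _ hzw
    have hne2 : S.zeta z * S.eta w - 1 ≠ 0 := by
      intro h
      have : ‖S.zeta z * S.eta w‖ = 1 := by rw [sub_eq_zero.1 h, norm_one]
      rw [norm_mul] at this
      nlinarith
    have e1 : (1 - S.zeta z * (S.eta w)⁻¹)⁻¹ = S.eta w / (S.eta w - S.zeta z) := by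
      rw [← inv_div]
      congr 1
      field_simp
    have e2 : (1 - (S.zeta z)⁻¹ * (S.eta w)⁻¹)⁻¹ =
        S.zeta z * S.eta w / (S.zeta z * S.eta w - 1) := by
      rw [← inv_div]
      congr 1
      field_simp
    have e3 : S.eta w + (S.eta w)⁻¹ - (S.zeta z + (S.zeta z)⁻¹) =
        (S.eta w - S.zeta z) * (S.zeta z * S.eta w - 1) / (S.zeta z * S.eta w) := by
      field_simp
      ring
    have hne3 : S.eta w * S.zeta z - 1 ≠ 0 := by rwa [mul_comm]
    rw [e1, e2, e3]
    field_simp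
    ring
  rw [h5, ← div_eq_mul_inv] at h4
  refine (h4.mul_left ((z - S.t₁) ^ l)).congr_fun fun k => ?_
  rw [genCoeff, eval_mul, eval_finsetSum, mul_assoc, Finset.sum_mul]
  simp only [eval_pow, eval_sub, eval_X, eval_C, eval_mul, eval_comp, eval_vPoly]
  congr 1
  refine Finset.sum_congr rfl fun ij hij => ?_
  rw [← Finset.HasAntidiagonal.mem_antidiagonal.1 hij, pow_add, S.zeta_add_inv hz]
  ring

/-- With `x = ψ(w) - t₁` and `u = z - t₁`, `x ^ n - u ^ n` equals `M (η + η⁻¹ - v(z))`. So `1 / (x -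
u)` is a sum of `x ^ (n - 1 - l) * u ^ l` over this, and the powers of `1 + ρ/η` in `x` and `ψ'`
combine to the exponent `-l / n`. -/
theorem deriv_inner_div {z w : ℂ} (hw : w ∈ S.dom)
    (hzw : ‖S.zeta z‖ < ‖S.eta w‖) :
    deriv S.inner w / (S.inner w - z) = ∑ l ∈ Finset.range S.n, (w - S.t₂) ^ (S.n - 1 - l) *
      ((z - S.t₁) ^ l * ((S.eta w - (S.eta w)⁻¹) / (S.eta w + (S.eta w)⁻¹ - S.v z) *
        (1 + S.ρ / S.eta w) ^ (-(l * (S.n : ℂ)⁻¹)))) * (S.M * S.eta w)⁻¹ := by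
  have hη0 := S.eta_ne_zero hw
  have hM := S.M_ne_zero
  have hy := Complex.slitPlane_ne_zero (S.one_add_div_mem_slitPlane hw)
  have hinner := S.inner_sub_pow hw
  rw [(S.hasDerivAt_inner hw).deriv]
  have hx : S.inner w - S.t₁ = (w - S.t₂) * (1 + S.ρ / S.eta w) ^ ((S.n : ℂ)⁻¹) := by
    rw [inner, add_sub_cancel_left]
  have hsn := Complex.cpow_nat_inv_pow (1 + S.ρ / S.eta w) S.n_ne_zero
  have hsl : ∀ l : ℕ, (1 + S.ρ / S.eta w) ^ (-(l * (S.n : ℂ)⁻¹)) =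
      (((1 + S.ρ / S.eta w) ^ ((S.n : ℂ)⁻¹)) ^ l)⁻¹ := fun l => by
    rw [Complex.cpow_neg, Complex.cpow_nat_mul]
  have hs1 : (1 + S.ρ / S.eta w) ^ ((S.n : ℂ)⁻¹ - 1) =
      (1 + S.ρ / S.eta w) ^ ((S.n : ℂ)⁻¹) / (1 + S.ρ / S.eta w) := by
    rw [Complex.cpow_sub _ _ hy, Complex.cpow_one]
  simp only [hsl, hs1]
  have hs0 : (1 + S.ρ / S.eta w) ^ ((S.n : ℂ)⁻¹) ≠ 0 := fun h => by
    rw [h, zero_pow S.n_ne_zero] at hsn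
    exact hy hsn.symm
  have hne : S.eta w + (S.eta w)⁻¹ - S.v z ≠ 0 := by
    intro h
    have h1 := joukowskiInv_add_inv hw
    rw [sub_eq_zero.1 h] at h1
    rw [← h1] at hzw
    exact lt_irrefl _ hzw
  have hzn : (z - S.t₁) ^ S.n = S.M * (S.v z + S.ρ + (S.ρ : ℂ)⁻¹) := by
    rw [v]
    field_simp
    ring
  set y := 1 + S.ρ / S.eta w
  set s := y ^ ((S.n : ℂ)⁻¹)
  set x := S.inner w - S.t₁ with hxdef
  set u := z - S.t₁ with hu
  set g := S.eta w + (S.eta w)⁻¹ - S.v z with hg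
  have hgeom : (x - u) * ∑ l ∈ Finset.range S.n, x ^ (S.n - 1 - l) * u ^ l = S.M * g := by
    have h1 := geom_sum₂_mul u x S.n
    have h2 : ∑ l ∈ Finset.range S.n, x ^ (S.n - 1 - l) * u ^ l =
        ∑ l ∈ Finset.range S.n, u ^ l * x ^ (S.n - 1 - l) :=
      Finset.sum_congr rfl fun l _ => mul_comm _ _
    rw [h2]
    linear_combination (-1 : ℂ) * h1 + hinner - hzn + S.M * hg
  have hxu : x - u ≠ 0 := left_ne_zero_of_mul (hgeom.symm ▸ mul_ne_zero hM hne)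
  have hsum : ∀ l ∈ Finset.range S.n, (w - S.t₂) ^ (S.n - 1 - l) * (u ^ l *
      ((S.eta w - (S.eta w)⁻¹) / g * (s ^ l)⁻¹)) * (S.M * S.eta w)⁻¹ =
      ((S.eta w - (S.eta w)⁻¹) / g * (S.M * S.eta w)⁻¹ * (s ^ (S.n - 1))⁻¹) *
        (x ^ (S.n - 1 - l) * u ^ l) := by
    intro l hl
    have hsplit : s ^ (S.n - 1) = s ^ (S.n - 1 - l) * s ^ l := by
      rw [← pow_add]
      congr 1
      have := Finset.mem_range.1 hl
      omega
    rw [hx, hsplit, mul_pow]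
    field_simp
  rw [Finset.sum_congr rfl hsum, ← Finset.mul_sum, eq_div_of_mul_eq hxu ((mul_comm _ _).trans hgeom),
    show S.inner w - z = x - u by rw [hxdef, hu]; ring]
  have hys : y = s * s ^ (S.n - 1) := by rw [mul_pow_sub_one S.n_ne_zero, hsn]
  rw [hys]
  field_simp

/-- The index is split as `n k + s`. By periodicity `u_{nk+s+1} = (M η) ^ k u_{s+1}`, so each
residue class is a series in `η⁻¹`; summing over `s` reassembles `(w - t₂) ^ (n - 1 - l)` from its
Newton expansion. -/
theorem hasSum_faberWalsh {α : ℕ → ℂ} (hper : ∀ i, α (i + S.n) = α i)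
    (hprod : ∀ w, nodePoly α S.n w = S.M * S.eta w) {z w : ℂ} (hz : z ∉ S.star) (hw : w ∈ S.dom)
    (hzw : ‖S.zeta z‖ < ‖S.eta w‖) :
    HasSum (fun k => (S.faberWalsh α k).eval z / nodePoly α (k + 1) w)
      (deriv S.inner w / (S.inner w - z)) := by
  have hη0 := S.eta_ne_zero hw
  have hM := S.M_ne_zero
  set γ : ℕ → ℂ := fun i => α (S.n - 1 - i) - S.t₂ with hγ
  set B : ℕ → ℂ := fun l => (z - S.t₁) ^ l * ((S.eta w - (S.eta w)⁻¹) /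
    (S.eta w + (S.eta w)⁻¹ - S.v z) * (1 + S.ρ / S.eta w) ^ (-(l * (S.n : ℂ)⁻¹))) with hB
  have hfib : ∀ s < S.n, HasSum (fun k => (S.faberWalsh α (S.n * k + s)).eval z /
      nodePoly α (S.n * k + s + 1) w) (∑ l ∈ Finset.range S.n,
        newtonCoeff γ (S.n - 1 - l) (S.n - 1 - s) * nodePoly γ (S.n - 1 - s) (w - S.t₂) *
          (S.M * S.eta w)⁻¹ * B l) := by
    intro s hs
    refine (hasSum_sum fun l _ => (S.hasSum_genCoeff l hz hw hzw).mul_left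
      (newtonCoeff γ (S.n - 1 - l) (S.n - 1 - s) * nodePoly γ (S.n - 1 - s) (w - S.t₂) *
          (S.M * S.eta w)⁻¹)).congr_fun fun k => ?_
    have hdiv : (S.n * k + s) / S.n = k := by
      rw [Nat.mul_add_div S.n_pos, Nat.div_eq_of_lt hs, add_zero]
    have hmod : (S.n * k + s) % S.n = s := by rw [Nat.mul_add_mod, Nat.mod_eq_of_lt hs]
    have h1 := nodePoly_mul_nodePoly_reflect α w hs
    rw [hprod] at h1
    have h2 : nodePoly γ (S.n - 1 - s) (w - S.t₂) =
      nodePoly (fun i => α (S.n - 1 - i)) (S.n - 1 - s) w := nodePoly_sub _ _ _ _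
    have h3 : nodePoly α (s + 1) w ≠ 0 := left_ne_zero_of_mul (h1.symm ▸ mul_ne_zero hM hη0)
    rw [faberWalsh, hdiv, hmod, add_assoc, nodePoly_mul_add hper, hprod, eval_mul, eval_finsetSum,
      eval_C, Finset.mul_sum, Finset.sum_div]
    refine Finset.sum_congr rfl fun l _ => ?_
    rw [eval_mul, eval_C, h2, eq_div_of_mul_eq h3 ((mul_comm _ _).trans h1)]
    change _ * (newtonCoeff γ _ _ * _) / _ = _
    rw [mul_pow, inv_pow]
    field_simp
  have key := hasSum_of_hasSum_mul_add S.n_pos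
    (f := fun k => (S.faberWalsh α k).eval z / nodePoly α (k + 1) w) hfib
  rw [S.deriv_inner_div hw hzw]
  convert key using 1
  rw [Finset.sum_comm]
  refine Finset.sum_congr rfl fun l hl => ?_
  have hl := Finset.mem_range.1 hl
  rw [← sum_newtonCoeff_mul_nodePoly γ (w - S.t₂) (show S.n - 1 - l < S.n by omega),
    ← Finset.sum_range_reflect, Finset.sum_mul, Finset.sum_mul]
  refine Finset.sum_congr rfl fun s _ => ?_
  ring

end StarParam

/-! ### Chebyshev polynomials of a star -/

theorem sum_pow_pow_of_isPrimitiveRoot {n : ℕ} {ω : ℂ} (hω : IsPrimitiveRoot ω n) (m : ℕ) :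
    ∑ i ∈ Finset.range n, (ω ^ i) ^ m = if n ∣ m then (n : ℂ) else 0 := by
  have h1 : ∀ i, (ω ^ i) ^ m = (ω ^ m) ^ i := fun i => by rw [← pow_mul, ← pow_mul, mul_comm]
  simp only [h1]
  split_ifs with h
  · rw [(hω.pow_eq_one_iff_dvd m).2 h]
    simp
  · have h2 : ω ^ m - 1 ≠ 0 := sub_ne_zero.2 fun h' => h ((hω.pow_eq_one_iff_dvd m).1 h')
    have h3 := geom_sum_mul (ω ^ m) n
    rw [← pow_mul, mul_comm m n, pow_mul, hω.pow_eq_one, one_pow, sub_self] at h3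
    exact (mul_eq_zero.1 h3).resolve_right h2

/-- The sum of the values of a polynomial over the `n`-th roots of `a x + b` is a polynomial
in `x`. -/
theorem exists_polynomial_eval_eq_sum {n k : ℕ} {ω : ℂ} (hω : IsPrimitiveRoot ω n)
    {D : ℂ[X]} (hD : D.natDegree < n * k) (a b : ℂ) :
    ∃ h : ℂ[X], h.degree < k ∧ ∀ x y : ℂ, y ^ n = a * x + b →
      ∑ i ∈ Finset.range n, D.eval (ω ^ i * y) = h.eval x := by
  -- Summing over the rotations kills `y ^ m` unless `n ∣ m`, and then `y ^ m = (a x + b) ^ (m / n)`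
  -- with `m / n < k`.
  refine ⟨∑ m ∈ Finset.range (n * k), if n ∣ m then
    C (D.coeff m * n) * (C a * X + C b) ^ (m / n) else 0, ?_, ?_⟩
  · rw [← mem_degreeLT]
    refine Submodule.sum_mem _ fun m hm => ?_
    rw [mem_degreeLT]
    split_ifs
    · have h1 : (C (D.coeff m * n) * (C a * X + C b) ^ (m / n)).natDegree ≤ m / n := by
        refine (natDegree_C_mul_le _ _).trans ?_
        refine (natDegree_pow_le_of_le (m / n) natDegree_linear_le).trans_eq (mul_one _)
      refine (degree_le_of_natDegree_le h1).trans_lt ?_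
      exact_mod_cast Nat.div_lt_of_lt_mul (Finset.mem_range.1 hm)
    · rw [degree_zero]
      exact WithBot.bot_lt_coe _
  · intro x y hy
    have h1 : ∀ i ∈ Finset.range n, D.eval (ω ^ i * y) =
        ∑ m ∈ Finset.range (n * k), D.coeff m * y ^ m * (ω ^ i) ^ m := fun i _ => by
      rw [eval_eq_sum_range' hD]
      refine Finset.sum_congr rfl fun m _ => ?_
      rw [mul_pow]
      ring
    rw [Finset.sum_congr rfl h1, Finset.sum_comm, eval_finsetSum]
    refine Finset.sum_congr rfl fun m _ => ?_
    rw [← Finset.mul_sum, sum_pow_pow_of_isPrimitiveRoot hω]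
    split_ifs with hm
    · simp only [eval_mul, eval_pow, eval_add, eval_C, eval_X]
      rw [← hy, ← pow_mul, Nat.mul_div_cancel' hm]
      ring
    · simp

theorem eq_of_norm_le_of_re_eq {z : ℂ} {r : ℝ} (h : ‖z‖ ≤ r) (hre : z.re = r) : z = r := by
  have h0 : 0 ≤ r := (norm_nonneg z).trans h
  have h1 : ‖z‖ ^ 2 ≤ r ^ 2 := pow_le_pow_left₀ (norm_nonneg z) h 2
  rw [← Complex.normSq_eq_norm_sq, Complex.normSq_apply, hre] at h1
  have h2 : z.im = 0 := by nlinarith [sq_nonneg z.im]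
  exact Complex.ext (by simpa using hre) (by simpa using h2)

theorem eval_chebyshev_C_node {k j : ℕ} (hj : j ≤ k) :
    (Chebyshev.C ℂ k).eval (2 * (Chebyshev.node k j : ℂ)) = 2 * (-1) ^ j := by
  have h1 := congrArg (eval (Chebyshev.node k j : ℂ)) (Chebyshev.C_comp_two_mul_X ℂ k)
  rw [eval_comp, eval_mul, eval_mul, eval_X, ← Chebyshev.complex_ofReal_eval_T,
    Chebyshev.eval_T_real_node (Finset.mem_Iic.2 hj)] at h1
  simpa using h1

theorem norm_eval_chebyshev_C_le {v : ℂ} (hv : v ∈ joukowskiSlit) (k : ℕ) :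
    ‖(Chebyshev.C ℂ k).eval v‖ ≤ 2 := by
  obtain ⟨x, ⟨h1, h2⟩, rfl⟩ := hv
  have h3 : x = 2 * Real.cos (Real.arccos (x / 2)) := by
    rw [Real.cos_arccos (by linarith) (by linarith)]
    ring
  rw [← Chebyshev.complex_ofReal_eval_C, Complex.norm_real, h3, Chebyshev.C_two_mul_real_cos,
    norm_mul, Real.norm_of_nonneg zero_le_two, Real.norm_eq_abs]
  linarith [Real.abs_cos_le_one (((k : ℤ) : ℝ) * Real.arccos (x / 2))]

theorem natDegree_chebyshev_C (k : ℕ) : (Chebyshev.C ℂ k).natDegree = k := by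
  have : Invertible (2 : ℂ) := invertibleOfNonzero two_ne_zero
  rw [Chebyshev.C_eq_two_mul_T_comp_half_mul_X, ← C_ofNat, natDegree_C_mul two_ne_zero,
    natDegree_comp, Chebyshev.natDegree_T, natDegree_C_mul_X _ (by simp)]
  simp

theorem leadingCoeff_chebyshev_C {k : ℕ} (hk : k ≠ 0) : (Chebyshev.C ℂ k).leadingCoeff = 1 := by
  have : Invertible (2 : ℂ) := invertibleOfNonzero two_ne_zero
  obtain ⟨m, rfl⟩ := Nat.exists_eq_succ_of_ne_zero hk
  rw [Chebyshev.C_eq_two_mul_T_comp_half_mul_X, ← C_ofNat, leadingCoeff_mul, leadingCoeff_C,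
    leadingCoeff_comp (by rw [natDegree_C_mul_X _ (by simp)]; exact one_ne_zero),
    Chebyshev.leadingCoeff_T, Chebyshev.natDegree_T, leadingCoeff_C_mul_X]
  simp only [Int.natAbs_natCast, Nat.succ_eq_add_one, Nat.add_sub_cancel, invOf_eq_inv]
  rw [inv_pow, pow_succ]
  field_simp

namespace StarParam

variable (S : StarParam)

theorem natDegree_vPoly : S.vPoly.natDegree = S.n := by
  rw [vPoly, natDegree_sub_C, natDegree_C_mul (inv_ne_zero S.M_ne_zero), natDegree_pow,
    natDegree_X_sub_C, mul_one]

theorem leadingCoeff_vPoly : S.vPoly.leadingCoeff = (S.M : ℂ)⁻¹ := by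
  rw [vPoly, leadingCoeff_sub_of_degree_lt, leadingCoeff_mul, leadingCoeff_C, leadingCoeff_pow,
    leadingCoeff_X_sub_C, one_pow, mul_one]
  rw [degree_C_mul (inv_ne_zero S.M_ne_zero), degree_pow, degree_X_sub_C, nsmul_one]
  refine degree_C_le.trans_lt ?_
  exact_mod_cast S.n_pos

/-- The Chebyshev polynomial of degree `n k` of a star. -/
noncomputable def chebyshev (k : ℕ) : ℂ[X] := C ((S.M : ℂ) ^ k) * (Chebyshev.C ℂ k).comp S.vPoly

theorem natDegree_chebyshev (k : ℕ) : (S.chebyshev k).natDegree = S.n * k := by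
  rw [chebyshev, natDegree_C_mul (pow_ne_zero _ S.M_ne_zero), natDegree_comp, natDegree_vPoly,
    natDegree_chebyshev_C, mul_comm]

theorem monic_chebyshev {k : ℕ} (hk : k ≠ 0) : (S.chebyshev k).Monic := by
  have hM := pow_ne_zero k S.M_ne_zero
  rw [Monic, chebyshev, leadingCoeff_mul, leadingCoeff_C,
    leadingCoeff_comp (by rw [natDegree_vPoly]; exact S.n_ne_zero), leadingCoeff_chebyshev_C hk,
    natDegree_chebyshev_C, leadingCoeff_vPoly, one_mul, inv_pow, mul_inv_cancel₀ hM]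

theorem eval_chebyshev (k : ℕ) (z : ℂ) :
    (S.chebyshev k).eval z = S.M ^ k * (Chebyshev.C ℂ k).eval (S.v z) := by
  rw [chebyshev, eval_mul, eval_C, eval_comp, eval_vPoly]

theorem norm_eval_chebyshev_le (k : ℕ) {z : ℂ} (hz : z ∈ S.star) :
    ‖(S.chebyshev k).eval z‖ ≤ 2 * S.M ^ k := by
  rw [eval_chebyshev, norm_mul, norm_pow, Complex.norm_real, Real.norm_of_nonneg S.M_pos.le,
    mul_comm]
  exact mul_le_mul_of_nonneg_right (norm_eval_chebyshev_C_le hz k) (pow_nonneg S.M_pos.le k)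

theorem v_add_of_pow_eq {y x : ℂ} (hy : y ^ S.n = 2 * S.M * x + S.M * (S.ρ + (S.ρ : ℂ)⁻¹)) :
    S.v (S.t₁ + y) = 2 * x := by
  have hM := S.M_ne_zero
  have hρ := S.ρ_ne_zero
  rw [v, add_sub_cancel_left, hy]
  field_simp
  ring

theorem mem_star_of_v_eq {z : ℂ} {x : ℝ} (hx : x ∈ Set.Icc (-1 : ℝ) 1) (h : S.v z = 2 * x) :
    z ∈ S.star :=
  ⟨2 * x, ⟨by linarith [hx.1], by linarith [hx.2]⟩, by rw [h]; push_cast; ring⟩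

theorem exists_norm_eval_chebyshev_eq (k : ℕ) :
    ∃ z ∈ S.star, ‖(S.chebyshev k).eval z‖ = 2 * S.M ^ k := by
  obtain ⟨y, hy⟩ := IsAlgClosed.exists_pow_nat_eq
    (2 * S.M * ((1 : ℝ) : ℂ) + S.M * (S.ρ + (S.ρ : ℂ)⁻¹)) S.n_pos
  have h := S.v_add_of_pow_eq hy
  refine ⟨_, S.mem_star_of_v_eq (by simp) h, ?_⟩
  rw [eval_chebyshev, h, Complex.ofReal_one, mul_one, Chebyshev.C_eval_two, norm_mul, norm_pow,
    Complex.norm_real, Real.norm_of_nonneg S.M_pos.le, Complex.norm_ofNat, mul_comm]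

/-- On the fibre over the `j`-th extremal point the Chebyshev polynomial is `(-1) ^ j * 2 M ^ k`, so
`(-1) ^ j D` has nonpositive real part there. The fibre sums of `D` form a polynomial of degree
below `k`, whose divided difference over `k + 1` nodes vanishes. Its weights alternate in sign, so
every term is zero and `D` has `n (k + 1)` roots, more than its degree. -/
theorem eq_chebyshev_of_forall_norm_le {k : ℕ} (hk : k ≠ 0) {q : ℂ[X]} (hq : q.Monic)
    (hdeg : q.natDegree = S.n * k) (hle : ∀ z ∈ S.star, ‖q.eval z‖ ≤ 2 * S.M ^ k) :
    q = S.chebyshev k := by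
  have hM := S.M_pos
  have hM0 := S.M_ne_zero
  have hnk : 0 < S.n * k := Nat.mul_pos S.n_pos (Nat.pos_of_ne_zero hk)
  set D := q - S.chebyshev k with hDdef
  have hDdeg : D.natDegree < S.n * k := by
    by_cases hD0 : D = 0
    · rwa [hD0, natDegree_zero]
    · rw [natDegree_lt_iff_degree_lt hD0, ← hdeg, ← degree_eq_natDegree hq.ne_zero]
      refine degree_sub_lt_left ?_ hq.ne_zero ?_
      · rw [degree_eq_natDegree hq.ne_zero, degree_eq_natDegree (S.monic_chebyshev hk).ne_zero, hdeg,
          natDegree_chebyshev]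
      · rw [hq.leadingCoeff, (S.monic_chebyshev hk).leadingCoeff]
  obtain ⟨ω, hω⟩ : ∃ ω : ℂ, IsPrimitiveRoot ω S.n := ⟨_, Complex.isPrimitiveRoot_exp S.n S.n_ne_zero⟩
  have hroot : ∀ j : ℕ, ∃ y : ℂ, y ^ S.n =
      2 * S.M * (Chebyshev.node k j : ℂ) + S.M * (S.ρ + (S.ρ : ℂ)⁻¹) := fun j =>
    IsAlgClosed.exists_pow_nat_eq _ S.n_pos
  choose y hy using hroot
  have hrot : ∀ i j, (ω ^ i * y j) ^ S.n =
      2 * S.M * (Chebyshev.node k j : ℂ) + S.M * (S.ρ + (S.ρ : ℂ)⁻¹) := fun i j => by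
    rw [mul_pow, ← pow_mul, mul_comm i, pow_mul, hω.pow_eq_one, one_pow, one_mul, hy]
  have hv : ∀ i j, S.v (S.t₁ + ω ^ i * y j) = 2 * (Chebyshev.node k j : ℂ) := fun i j =>
    S.v_add_of_pow_eq (hrot i j)
  have hmem : ∀ i j, S.t₁ + ω ^ i * y j ∈ S.star := fun i j =>
    S.mem_star_of_v_eq Chebyshev.node_mem_Icc (hv i j)
  have hcheb : ∀ i j, j ≤ k →
      (S.chebyshev k).eval (S.t₁ + ω ^ i * y j) = (-1) ^ j * ((2 * S.M ^ k : ℝ) : ℂ) :=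
    fun i j hj => by
      rw [eval_chebyshev, hv, eval_chebyshev_C_node hj]
      push_cast
      ring
  have hsq : ∀ j : ℕ, ((-1 : ℂ) ^ j) * (-1) ^ j = 1 := fun j => by
    rw [← mul_pow]
    simp
  have hqnorm : ∀ i j, ‖(-1) ^ j * q.eval (S.t₁ + ω ^ i * y j)‖ ≤ 2 * S.M ^ k := fun i j => by
    rw [norm_mul, norm_pow, norm_neg, norm_one, one_pow, one_mul]
    exact hle _ (hmem i j)
  have hDeval : ∀ i j, j ≤ k → (-1) ^ j * D.eval (S.t₁ + ω ^ i * y j) =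
      (-1) ^ j * q.eval (S.t₁ + ω ^ i * y j) - ((2 * S.M ^ k : ℝ) : ℂ) := fun i j hj => by
    rw [hDdef, eval_sub, hcheb i j hj, mul_sub, ← mul_assoc, hsq, one_mul]
  have hDre : ∀ i j, j ≤ k → ((-1) ^ j * D.eval (S.t₁ + ω ^ i * y j)).re ≤ 0 := fun i j hj => by
    rw [hDeval i j hj, Complex.sub_re, Complex.ofReal_re]
    linarith [(Complex.re_le_norm _).trans (hqnorm i j)]
  have hcompdeg : (D.comp (X + C S.t₁)).natDegree < S.n * k := by
    rwa [natDegree_comp, natDegree_X_add_C, mul_one]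
  obtain ⟨g, hgdeg, hg⟩ := exists_polynomial_eval_eq_sum hω hcompdeg (2 * S.M)
    (S.M * (S.ρ + (S.ρ : ℂ)⁻¹))
  -- Lagrange weights of the decreasing nodes, made positive by the sign `(-1) ^ j`.
  set W : ℕ → ℝ := fun j => (-1) ^ j *
    (∏ l ∈ (Finset.range (k + 1)).erase j, (Chebyshev.node k j - Chebyshev.node k l))⁻¹ with hW
  have hWpos : ∀ j ≤ k, 0 < W j := fun j hj => by
    have := inv_pos_of_pos (Chebyshev.zero_lt_prod_node_sub_node hj)
    rwa [mul_inv, ← inv_pow, inv_neg_one] at this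
  have hsum : ∑ j ∈ Finset.range (k + 1), (W j : ℂ) * ((-1) ^ j *
      ∑ i ∈ Finset.range S.n, D.eval (S.t₁ + ω ^ i * y j)) = 0 := by
    have hinj : Set.InjOn (fun j => (Chebyshev.node k j : ℂ)) (Finset.range (k + 1)) :=
      fun a ha b hb hab => (Chebyshev.strictAntiOn_node k).injOn ha hb (Complex.ofReal_inj.1 hab)
    have hgk : g.degree < (Finset.range (k + 1)).card := by
      rw [Finset.card_range]
      exact hgdeg.trans (by exact_mod_cast Nat.lt_succ_self k)
    have h1 := Lagrange.coeff_eq_sum hinj hgk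
    rw [Finset.card_range, Nat.add_sub_cancel, coeff_eq_zero_of_degree_lt hgdeg] at h1
    rw [h1]
    refine Finset.sum_congr rfl fun j _ => ?_
    rw [← hg _ _ (hy j)]
    simp only [eval_comp, eval_add, eval_X, eval_C, hW]
    push_cast
    rw [div_eq_mul_inv]
    simp only [add_comm _ S.t₁]
    linear_combination ((∏ l ∈ (Finset.range (k + 1)).erase j,
      ((Chebyshev.node k j : ℂ) - Chebyshev.node k l))⁻¹ *
      ∑ i ∈ Finset.range S.n, D.eval (S.t₁ + ω ^ i * y j)) * hsq j
  have hre : ∑ j ∈ Finset.range (k + 1), ∑ i ∈ Finset.range S.n,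
      W j * ((-1) ^ j * D.eval (S.t₁ + ω ^ i * y j)).re = 0 := by
    have h1 := congrArg Complex.re hsum
    rw [Complex.re_sum, Complex.zero_re] at h1
    rw [← h1]
    refine Finset.sum_congr rfl fun j _ => ?_
    rw [Complex.re_ofReal_mul, Finset.mul_sum, Complex.re_sum, Finset.mul_sum]
  have hterm : ∀ j ∈ Finset.range (k + 1), ∀ i ∈ Finset.range S.n,
      W j * ((-1) ^ j * D.eval (S.t₁ + ω ^ i * y j)).re ≤ 0 := fun j hj i _ => by
    have hj := Nat.lt_succ_iff.1 (Finset.mem_range.1 hj)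
    exact mul_nonpos_of_nonneg_of_nonpos (hWpos j hj).le (hDre i j hj)
  have hDzero : ∀ j ∈ Finset.range (k + 1), ∀ i ∈ Finset.range S.n,
      D.eval (S.t₁ + ω ^ i * y j) = 0 := by
    intro j hj i hi
    have h1 := (Finset.sum_eq_zero_iff_of_nonpos fun j hj => Finset.sum_nonpos (hterm j hj)).1 hre j hj
    have h2 := (Finset.sum_eq_zero_iff_of_nonpos (hterm j hj)).1 h1 i hi
    have hj := Nat.lt_succ_iff.1 (Finset.mem_range.1 hj)
    have h3 := (mul_eq_zero.1 h2).resolve_left (hWpos j hj).ne'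
    rw [hDeval i j hj, Complex.sub_re, Complex.ofReal_re, sub_eq_zero] at h3
    -- Vanishing real part means that `(-1) ^ j q` attains its modulus bound in its real part, so
    -- the imaginary part of `D` vanishes as well.
    have h4 := eq_of_norm_le_of_re_eq (hqnorm i j) h3
    have h5 := hDeval i j hj
    rw [h4, sub_self] at h5
    exact (mul_eq_zero.1 h5).resolve_left (pow_ne_zero _ (by norm_num))
  -- `ρ + ρ⁻¹ > 2` keeps the fibres away from the branch point `t₁`, so each consists of `n`
  -- distinct points.
  have hy0 : ∀ j, y j ≠ 0 := fun j h0 => by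
    have h1 := hy j
    rw [h0, zero_pow S.n_ne_zero] at h1
    have h2 : (0 : ℝ) = 2 * S.M * Chebyshev.node k j + S.M * (S.ρ + S.ρ⁻¹) := by exact_mod_cast h1
    have h3 := two_lt_add_inv ((one_lt_inv₀ S.ρ_pos).2 S.ρ_lt)
    rw [inv_inv] at h3
    have h4 := (Chebyshev.node_mem_Icc (n := k) (i := j)).1
    nlinarith
  have hinj : Set.InjOn (fun ij : ℕ × ℕ => S.t₁ + ω ^ ij.1 * y ij.2)
      (Finset.range S.n ×ˢ Finset.range (k + 1) : Finset (ℕ × ℕ)) := by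
    rintro ⟨i, j⟩ hij ⟨i', j'⟩ hij' h
    have hij := Finset.mem_product.1 (Finset.mem_coe.1 hij)
    have hij' := Finset.mem_product.1 (Finset.mem_coe.1 hij')
    have h : S.t₁ + ω ^ i * y j = S.t₁ + ω ^ i' * y j' := h
    have h1 := congrArg S.v h
    rw [hv, hv] at h1
    have h2 : j = j' := (Chebyshev.strictAntiOn_node k).injOn (Finset.mem_coe.2 hij.2)
      (Finset.mem_coe.2 hij'.2) (Complex.ofReal_inj.1 (mul_left_cancel₀ two_ne_zero h1))
    subst h2
    have h3 := hω.pow_inj (Finset.mem_range.1 hij.1) (Finset.mem_range.1 hij'.1)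
      (mul_right_cancel₀ (hy0 j) (add_left_cancel h))
    exact Prod.ext h3 rfl
  have hD : D = 0 := by
    refine eq_zero_of_natDegree_lt_card_of_eval_eq_zero' D
      ((Finset.range S.n ×ˢ Finset.range (k + 1)).image fun ij : ℕ × ℕ => S.t₁ + ω ^ ij.1 * y ij.2)
      ?_ ?_
    · intro z hz
      obtain ⟨⟨i, j⟩, hij, rfl⟩ := Finset.mem_image.1 hz
      have hij := Finset.mem_product.1 hij
      exact hDzero j hij.2 i hij.1
    · rw [Finset.card_image_of_injOn hinj, Finset.card_product, Finset.card_range, Finset.card_range]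
      exact hDdeg.trans_le (Nat.mul_le_mul_left _ (Nat.le_succ k))
  exact sub_eq_zero.1 hD

theorem isCompact_star : IsCompact S.star :=
  Metric.isCompact_of_isClosed_isBounded S.isClosed_star (isBounded_def.2 S.eventually_notMem_star)

theorem norm_eval_le_supNormOn (p : ℂ[X]) {z : ℂ} (hz : z ∈ S.star) :
    ‖p.eval z‖ ≤ supNormOn S.star p :=
  le_csSup (S.isCompact_star.image p.continuous.norm).bddAbove ⟨z, hz, rfl⟩

theorem supNormOn_chebyshev (k : ℕ) : supNormOn S.star (S.chebyshev k) = 2 * S.M ^ k := by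
  obtain ⟨z, hz, hz'⟩ := S.exists_norm_eval_chebyshev_eq k
  refine le_antisymm (csSup_le ⟨_, z, hz, rfl⟩ ?_) (hz' ▸ S.norm_eval_le_supNormOn _ hz)
  rintro _ ⟨x, hx, rfl⟩
  exact S.norm_eval_chebyshev_le k hx

theorem isChebyshevPoly_iff (α : ℕ → ℂ) (k : ℕ) (p : ℂ[X]) :
    IsChebyshevPoly S.star (S.n * k) p ↔ p = S.faberWalsh α (S.n * k) := by
  rw [faberWalsh_mul, intervalFaber]
  split_ifs with hk
  · subst hk
    have h1 : ∀ q : ℂ[X], q.Monic → q.natDegree = S.n * 0 → q = 1 := fun q hq hd =>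
      hq.natDegree_eq_zero.1 hd
    constructor
    · rintro ⟨hp, hd, -⟩
      simpa using h1 p hp hd
    · intro hp
      have hp : p = 1 := by simpa using hp
      subst hp
      exact ⟨monic_one, by simp, fun q hq hd => by rw [h1 q hq hd]⟩
  · change _ ↔ p = S.chebyshev k
    constructor
    · rintro ⟨hp, hd, hmin⟩
      refine S.eq_chebyshev_of_forall_norm_le hk hp hd fun z hz =>
        (S.norm_eval_le_supNormOn p hz).trans ?_
      exact (hmin _ (S.monic_chebyshev hk) (S.natDegree_chebyshev k)).trans_eq
        (S.supNormOn_chebyshev k)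
    · rintro rfl
      refine ⟨S.monic_chebyshev hk, S.natDegree_chebyshev k, fun q hq hd => ?_⟩
      by_contra hlt
      rw [not_le] at hlt
      have h1 := S.eq_chebyshev_of_forall_norm_le hk hq hd fun z hz =>
        ((S.norm_eval_le_supNormOn q hz).trans hlt.le).trans_eq (S.supNormOn_chebyshev k)
      rw [h1] at hlt
      exact lt_irrefl _ hlt

end StarParam

/-! ### Periodic sequences of foci -/

section Periodic

variable {α : ℕ → ℂ} {n : ℕ}

theorem apply_mod_of_periodic (hper : ∀ i, α (i + n) = α i) (i : ℕ) : α (i % n) = α i :=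
  Function.Periodic.map_mod_nat hper i

theorem card_filter_eq_of_periodic (hn : 0 < n) (hper : ∀ i, α (i + n) = α i)
    (hinj : Set.InjOn α (Finset.range n)) (k : ℕ) {j : ℕ} (hj : j < n) :
    ((Finset.range k).filter fun i => α i = α j).card = k / n + if j < k % n then 1 else 0 := by
  have h1 := Nat.count_modEq_card k hn j
  rw [Nat.mod_eq_of_lt hj] at h1
  rw [← h1, Nat.count_eq_card_filter_range]
  congr 1
  refine Finset.filter_congr fun i _ => ?_
  rw [← apply_mod_of_periodic hper i]
  constructor
  · intro h
    have := hinj (Finset.mem_coe.2 (Finset.mem_range.2 (Nat.mod_lt i hn)))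
      (Finset.mem_coe.2 (Finset.mem_range.2 hj)) h
    rw [Nat.ModEq, this, Nat.mod_eq_of_lt hj]
  · intro h
    rw [Nat.ModEq, Nat.mod_eq_of_lt hj] at h
    rw [h]

theorem isAdmissibleSeq_of_periodic (hn : 0 < n) (hper : ∀ i, α (i + n) = α i)
    (hinj : Set.InjOn α (Finset.range n)) :
    IsAdmissibleSeq (fun j : Fin n => α j) (fun _ => (n : ℝ)⁻¹) α := by
  refine ⟨fun i => ⟨⟨i % n, Nat.mod_lt i hn⟩, apply_mod_of_periodic hper i⟩, 1, one_pos,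
    fun j k => ?_⟩
  rw [card_filter_eq_of_periodic hn hper hinj k j.2]
  have hn' : (0 : ℝ) < n := Nat.cast_pos.2 hn
  have h1 : (k : ℝ) * (n : ℝ)⁻¹ = (k / n : ℕ) + ((k % n : ℕ) : ℝ) / n := by
    have : (k : ℝ) = n * (k / n : ℕ) + (k % n : ℕ) := by exact_mod_cast (Nat.div_add_mod k n).symm
    rw [this]
    field_simp
  have h2 : ((k % n : ℕ) : ℝ) / n < 1 :=
    (div_lt_one hn').2 (Nat.cast_lt.2 (Nat.mod_lt k hn))
  have h3 : 0 ≤ ((k % n : ℕ) : ℝ) / n := by positivity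
  rw [h1, abs_le]
  push_cast
  split_ifs <;> constructor <;> linarith

/-- After `K` full periods a focus has occurred `K` times, so `K * |1 - n m_j|` stays bounded and
`m_j = 1 / n`. A focus that never occurs would have exponent `0`. -/
theorem exponent_eq_and_image_eq_of_isAdmissibleSeq (hn : 0 < n) (hper : ∀ i, α (i + n) = α i)
    (hinj : Set.InjOn α (Finset.range n)) {N : ℕ} {a : Fin N → ℂ} {m : Fin N → ℝ}
    (hm : ∀ j, 0 < m j) (h : IsAdmissibleSeq a m α) :
    (∀ j, m j = (n : ℝ)⁻¹) ∧ Finset.univ.image a = (Finset.range n).image α := by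
  obtain ⟨hrange, A, -, hA⟩ := h
  have hn' : (0 : ℝ) < n := Nat.cast_pos.2 hn
  have hbdd : ∀ x : ℝ, (∀ K : ℕ, (K : ℝ) * |x| ≤ A) → x = 0 := by
    intro x hx
    by_contra hx0
    obtain ⟨K, hK⟩ := exists_nat_gt (A / |x|)
    have := hx K
    rw [div_lt_iff₀ (abs_pos.2 hx0)] at hK
    linarith
  have hmem : ∀ j, ∃ i < n, a j = α i := by
    intro j
    by_contra hcon
    have hne : ∀ i, α i ≠ a j := fun i hi =>
      hcon ⟨i % n, Nat.mod_lt i hn, by rw [apply_mod_of_periodic hper, hi]⟩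
    refine (hm j).ne' (hbdd _ fun K => ?_)
    have := hA j K
    rwa [Finset.filter_false_of_mem fun i _ => hne i, Finset.card_empty, Nat.cast_zero, zero_sub,
      abs_neg, abs_mul, Nat.abs_cast] at this
  constructor
  · intro j
    obtain ⟨i, hi, hji⟩ := hmem j
    have h0 : 1 - n * m j = 0 := by
      refine hbdd _ fun K => ?_
      have := hA j (n * K)
      rw [hji, card_filter_eq_of_periodic hn hper hinj _ hi, Nat.mul_div_cancel_left _ hn,
        Nat.mul_mod_right, if_neg (Nat.not_lt_zero i), add_zero] at this
      rwa [← Nat.abs_cast K, ← abs_mul, mul_sub, mul_one,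
        show (K : ℝ) * (n * m j) = ((n * K : ℕ) : ℝ) * m j by push_cast; ring]
    field_simp
    linarith
  · ext x
    simp only [Finset.mem_image, Finset.mem_univ, true_and, Finset.mem_range]
    constructor
    · rintro ⟨j, rfl⟩
      obtain ⟨i, hi, hji⟩ := hmem j
      exact ⟨i, hi, hji.symm⟩
    · rintro ⟨i, -, rfl⟩
      exact hrange i

theorem absU_pow_eq (hn : 0 < n) (hinj : Set.InjOn α (Finset.range n)) {N : ℕ} {a : Fin N → ℂ}
    {m : Fin N → ℝ} (ha : Function.Injective a) (hm : ∀ j, m j = (n : ℝ)⁻¹)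
    (himage : Finset.univ.image a = (Finset.range n).image α) (w : ℂ) :
    absU a m w ^ n = ‖nodePoly α n w‖ := by
  rw [absU, ← Finset.prod_pow, nodePoly, ← Finset.prod_image (f := fun x => w - x) hinj, ← himage,
    Finset.prod_image ha.injOn, norm_prod]
  refine Finset.prod_congr rfl fun j _ => ?_
  rw [hm, Real.rpow_inv_natCast_pow (norm_nonneg _) hn.ne']

end Periodic

/-! ### Existence and uniqueness of the Faber–Walsh polynomials of a star -/

namespace StarParam

variable (S : StarParam)

theorem infinite_compl_star : (S.starᶜ).Infinite := by
  intro hfin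
  have h1 := isBounded_def.1 hfin.isBounded
  have h2 := inter_mem h1 S.eventually_notMem_star
  rw [show (S.starᶜ)ᶜ ∩ {z | z ∉ S.star} = ∅ from Set.compl_inter_self _] at h2
  exact empty_notMem _ h2

section FaberWalsh

variable {S} {α : ℕ → ℂ}

theorem norm_nodePoly_eq (hprod : ∀ w, nodePoly α S.n w = S.M * S.eta w) (w : ℂ) :
    ‖nodePoly α S.n w‖ = S.M * ‖S.eta w‖ := by
  rw [hprod, norm_mul, Complex.norm_real, Real.norm_of_nonneg S.M_pos.le]

theorem inverseMap_eq_inner {Φ : ℂ → ℂ} (hΦ : ∀ z, z ∉ S.star → Φ z = S.outer z) {w : ℂ}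
    (hw : w ∈ S.dom) : inverseMap S.star Φ w = S.inner w := by
  have hex : ∃ z ∈ S.starᶜ, Φ z = w :=
    ⟨S.inner w, S.inner_notMem_star hw, by rw [hΦ _ (S.inner_notMem_star hw), S.outer_inner hw]⟩
  have h1 : inverseMap S.star Φ w ∉ S.star := Function.invFunOn_mem hex
  have h2 : Φ (inverseMap S.star Φ w) = w := Function.invFunOn_eq hex
  rw [hΦ _ h1] at h2
  rw [← S.inner_outer h1, h2]

theorem deriv_inverseMap_eq {Φ : ℂ → ℂ} (hΦ : ∀ z, z ∉ S.star → Φ z = S.outer z) {w : ℂ}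
    (hw : w ∈ S.dom) : deriv (inverseMap S.star Φ) w = deriv S.inner w :=
  Filter.EventuallyEq.deriv_eq (mem_of_superset (S.isOpen_dom.mem_nhds hw)
    fun _ hx => inverseMap_eq_inner hΦ hx)

theorem isFaberWalsh_faberWalsh
    (hper : ∀ i, α (i + S.n) = α i)
    (hprod : ∀ w, nodePoly α S.n w = S.M * S.eta w) (hinj : Set.InjOn α (Finset.range S.n)) : IsFaberWalsh S.star α (S.faberWalsh α) := by
  have hM := S.M_pos
  have ha : Function.Injective fun j : Fin S.n => α j := fun i j hij =>
    Fin.ext (hinj (Finset.mem_coe.2 (Finset.mem_range.2 i.2))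
      (Finset.mem_coe.2 (Finset.mem_range.2 j.2)) hij)
  have himage : Finset.univ.image (fun j : Fin S.n => α j) = (Finset.range S.n).image α := by
    ext x
    simp only [Finset.mem_image, Finset.mem_univ, true_and, Finset.mem_range]
    exact ⟨fun ⟨j, hj⟩ => ⟨j, j.2, hj⟩, fun ⟨i, hi, hx⟩ => ⟨⟨i, hi⟩, hx⟩⟩
  have hU : ∀ w, absU (fun j : Fin S.n => α j) (fun _ => (S.n : ℝ)⁻¹) w ^ S.n =
      S.M * ‖S.eta w‖ := fun w => by
    rw [absU_pow_eq S.n_pos hinj ha (fun _ => rfl) himage, norm_nodePoly_eq hprod]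
  have hU0 : ∀ w, 0 ≤ absU (fun j : Fin S.n => α j) (fun _ => (S.n : ℝ)⁻¹) w := fun w =>
    Finset.prod_nonneg fun j _ => Real.rpow_nonneg (norm_nonneg _) _
  have hμ : (S.M ^ ((S.n : ℝ)⁻¹)) ^ S.n = S.M := Real.rpow_inv_natCast_pow hM.le S.n_ne_zero
  have hμ0 : 0 < S.M ^ ((S.n : ℝ)⁻¹) := Real.rpow_pos_of_pos hM _
  have hdom : lemniscaticDomain (fun j : Fin S.n => α j) (fun _ => (S.n : ℝ)⁻¹)
      (S.M ^ ((S.n : ℝ)⁻¹)) = S.dom := by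
    ext w
    change S.M ^ ((S.n : ℝ)⁻¹) < absU _ _ w ↔ 1 < ‖S.eta w‖
    rw [← pow_lt_pow_iff_left₀ hμ0.le (hU0 w) S.n_ne_zero, hμ, hU]
    exact lt_mul_iff_one_lt_right hM
  refine ⟨S.n, fun j => α j, fun _ => (S.n : ℝ)⁻¹, S.M ^ ((S.n : ℝ)⁻¹), S.outer, ?_,
    isAdmissibleSeq_of_periodic S.n_pos hper hinj, ?_⟩
  · refine ⟨ha, fun _ => inv_pos.2 (Nat.cast_pos.2 S.n_pos), ?_, hμ0,
      fun z hz => (S.differentiableAt_outer hz).differentiableWithinAt, ?_, S.isBigO_outer⟩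
    · have : (S.n : ℝ) ≠ 0 := Nat.cast_ne_zero.2 S.n_ne_zero
      simp [this]
    · rw [hdom]
      exact S.bijOn_outer
  · intro σ hσ z hz hzσ w hw
    have h1 : ‖S.zeta z‖ < ‖S.eta w‖ := by
      rw [← hzσ, ← pow_lt_pow_iff_left₀ (hU0 _) (hU0 w) S.n_ne_zero, hU, hU, S.eta_outer hz] at hw
      exact lt_of_mul_lt_mul_left hw hM.le
    have hwd : w ∈ S.dom := (S.one_lt_norm_zeta hz).trans h1
    rw [deriv_inverseMap_eq (fun _ _ => rfl) hwd, inverseMap_eq_inner (fun _ _ => rfl) hwd]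
    exact S.hasSum_faberWalsh hper hprod hz hwd h1

theorem eq_faberWalsh_of_isFaberWalsh
    (hper : ∀ i, α (i + S.n) = α i)
    (hprod : ∀ w, nodePoly α S.n w = S.M * S.eta w) (hinj : Set.InjOn α (Finset.range S.n))
    {b : ℕ → ℂ[X]} (hb : IsFaberWalsh S.star α b) :
    b = S.faberWalsh α := by
  have hM := S.M_pos
  obtain ⟨N, a, m, μ, Φ, hΦ, hadm, hsum⟩ := hb
  obtain ⟨hm, himage⟩ := exponent_eq_and_image_eq_of_isAdmissibleSeq S.n_pos hper hinj
    hΦ.exponent_pos hadm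
  have hU : ∀ w, absU a m w ^ S.n = S.M * ‖S.eta w‖ := fun w => by
    rw [absU_pow_eq S.n_pos hinj hΦ.foci_injective hm himage, norm_nodePoly_eq hprod]
  have hU0 : ∀ w, 0 ≤ absU a m w := fun w =>
    Finset.prod_nonneg fun j _ => Real.rpow_nonneg (norm_nonneg _) _
  have heq : ∀ z, z ∉ S.star → Φ z = S.outer z := fun z hz => eq_outer_of_isLemniscaticMap hΦ hU hz
  have hbound : ∀ i, ‖α i‖ ≤ ∑ j ∈ Finset.range S.n, ‖α j‖ := fun i => by
    rw [← apply_mod_of_periodic hper i]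
    exact Finset.single_le_sum (f := fun j => ‖α j‖) (fun j _ => norm_nonneg _)
      (Finset.mem_range.2 (Nat.mod_lt i S.n_pos))
  have hzero : ∀ z, z ∉ S.star → (fun k => (b k).eval z - (S.faberWalsh α k).eval z) = 0 := by
    intro z hz
    refine coeff_eq_zero_of_hasSum_div_nodePoly hbound ?_
    have hev := tendsto_norm_cobounded_atTop.comp S.tendsto_eta |>.eventually_gt_atTop ‖S.zeta z‖
    filter_upwards [hev] with w hw
    have hw : ‖S.zeta z‖ < ‖S.eta w‖ := hw
    have hwd : w ∈ S.dom := (S.one_lt_norm_zeta hz).trans hw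
    have hμ := hΦ.level_pos
    have h1 : μ < absU a m (Φ z) := hΦ.bijOn.mapsTo hz
    -- The parameter `σ` is read off from the level curve through `Φ z`; it exceeds `1` since `Φ z`
    -- lies in the domain.
    have h2 := hsum (absU a m (Φ z) / μ) ((one_lt_div hμ).2 h1) z hz
      (div_mul_cancel₀ _ hμ.ne').symm w (by
        rw [div_mul_cancel₀ _ hμ.ne', ← pow_lt_pow_iff_left₀ (hU0 _) (hU0 w) S.n_ne_zero, hU, hU,
          heq z hz, S.eta_outer hz]
        exact mul_lt_mul_of_pos_left hw hM)
    rw [deriv_inverseMap_eq heq hwd, inverseMap_eq_inner heq hwd] at h2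
    have h3 := h2.sub (S.hasSum_faberWalsh hper hprod hz hwd hw)
    rw [sub_self] at h3
    exact h3.congr_fun fun k => by rw [sub_div]
  ext1 k
  refine Polynomial.eq_of_infinite_eval_eq _ _ (S.infinite_compl_star.mono fun z hz => ?_)
  exact sub_eq_zero.1 (congrFun (hzero z hz) k)

theorem exists_isFaberWalsh_and_isChebyshevPoly_iff
    (hper : ∀ i, α (i + S.n) = α i)
    (hprod : ∀ w, nodePoly α S.n w = S.M * S.eta w) (hinj : Set.InjOn α (Finset.range S.n)) :
    (∃ b : ℕ → ℂ[X], IsFaberWalsh S.star α b) ∧ ∀ b : ℕ → ℂ[X], IsFaberWalsh S.star α b →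
      ∀ (k : ℕ) (p : ℂ[X]), IsChebyshevPoly S.star (S.n * k) p ↔ p = b (S.n * k) := by
  refine ⟨⟨_, isFaberWalsh_faberWalsh hper hprod hinj⟩, fun b hb k p => ?_⟩
  rw [eq_faberWalsh_of_isFaberWalsh hper hprod hinj hb]
  exact S.isChebyshevPoly_iff α k p

end FaberWalsh

end StarParam

/-! ### The star of intervals and the two intervals as special cases -/

namespace StarParam

/-- The parameters of the star `{z | (z - t₁) ^ n ∈ [Q ^ 2, P ^ 2]}`. -/
noncomputable def ofRadii (n : ℕ) (P Q : ℝ) (t₁ t₂ : ℂ) (hn : 0 < n) (hQ : 0 < Q) (hPQ : Q < P)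
    (h : (n = 1 ∧ t₂ = t₁ + ((P - Q) ^ 2 / 4 : ℝ)) ∨ (2 ≤ n ∧ t₂ = t₁)) : StarParam where
  n := n
  M := (P ^ 2 - Q ^ 2) / 4
  ρ := (P - Q) / (P + Q)
  t₁ := t₁
  t₂ := t₂
  n_pos := hn
  M_pos := by nlinarith
  ρ_pos := div_pos (by linarith) (by linarith)
  ρ_lt := (div_lt_one (by linarith)).2 (by linarith)
  shift := by
    have h1 : (P ^ 2 - Q ^ 2) / 4 * ((P - Q) / (P + Q)) = (P - Q) ^ 2 / 4 := by
      have : P + Q ≠ 0 := by linarith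
      field_simp
      ring
    rwa [← Complex.ofReal_mul, h1]

variable {n : ℕ} {P Q : ℝ} {t₁ t₂ : ℂ} (hn : 0 < n) (hQ : 0 < Q) (hPQ : Q < P)
  (h : (n = 1 ∧ t₂ = t₁ + ((P - Q) ^ 2 / 4 : ℝ)) ∨ (2 ≤ n ∧ t₂ = t₁))

theorem mem_star_ofRadii_iff (z : ℂ) : z ∈ (ofRadii n P Q t₁ t₂ hn hQ hPQ h).star ↔
    ∃ x ∈ Set.Icc (Q ^ 2) (P ^ 2), (z - t₁) ^ n = (x : ℂ) := by
  have hM : 0 < P ^ 2 - Q ^ 2 := by nlinarith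
  have hPQ0 : P + Q ≠ 0 := by linarith
  have hPQ1 : P - Q ≠ 0 := by linarith
  have hMc : ((P ^ 2 - Q ^ 2 : ℝ) : ℂ) ≠ 0 := Complex.ofReal_ne_zero.2 hM.ne'
  have hv : (ofRadii n P Q t₁ t₂ hn hQ hPQ h).v z =
      (4 * (z - t₁) ^ n - ((2 * (P ^ 2 + Q ^ 2) : ℝ) : ℂ)) / ((P ^ 2 - Q ^ 2 : ℝ) : ℂ) := by
    have h1 : (P - Q) / (P + Q) + ((P - Q) / (P + Q))⁻¹ =
        2 * (P ^ 2 + Q ^ 2) / (P ^ 2 - Q ^ 2) := by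
      rw [show P ^ 2 - Q ^ 2 = (P - Q) * (P + Q) by ring]
      field_simp
      ring
    change (z - t₁) ^ n / (((P ^ 2 - Q ^ 2) / 4 : ℝ) : ℂ) - (((P - Q) / (P + Q) : ℝ) : ℂ) -
      (((P - Q) / (P + Q) : ℝ) : ℂ)⁻¹ = _
    rw [sub_sub, ← Complex.ofReal_inv, ← Complex.ofReal_add, h1, Complex.ofReal_div (2 * _),
      Complex.ofReal_div _ 4, Complex.ofReal_ofNat]
    generalize ((P ^ 2 - Q ^ 2 : ℝ) : ℂ) = m at hMc
    field_simp
  change _ ∈ joukowskiSlit ↔ _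
  rw [hv]
  constructor
  · rintro ⟨x, ⟨h1, h2⟩, hx⟩
    refine ⟨(x * (P ^ 2 - Q ^ 2) + 2 * (P ^ 2 + Q ^ 2)) / 4, ⟨by nlinarith, by nlinarith⟩, ?_⟩
    rw [eq_div_iff hMc] at hx
    push_cast at hx ⊢
    linear_combination -hx / 4
  · rintro ⟨x, ⟨h1, h2⟩, hx⟩
    refine ⟨(4 * x - 2 * (P ^ 2 + Q ^ 2)) / (P ^ 2 - Q ^ 2), ⟨?_, ?_⟩, ?_⟩
    · rw [le_div_iff₀ hM]
      linarith
    · rw [div_le_iff₀ hM]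
      linarith
    · rw [hx]
      push_cast
      ring

/-- `M / ρ = ((P + Q) / 2) ^ 2`, so the foci are `t₂` plus the `n`-th roots of this number. -/
theorem M_mul_eta_ofRadii (w : ℂ) : ((ofRadii n P Q t₁ t₂ hn hQ hPQ h).M : ℂ) *
    (ofRadii n P Q t₁ t₂ hn hQ hPQ h).eta w = (w - t₂) ^ n - ((((P + Q) / 2) ^ 2 : ℝ) : ℂ) := by
  rw [show (w - t₂) ^ n = _ from (ofRadii n P Q t₁ t₂ hn hQ hPQ h).sub_pow_eq_eta w]
  have hPQ0 : P + Q ≠ 0 := by linarith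
  have hPQ1 : P - Q ≠ 0 := by linarith
  have h1 : (P ^ 2 - Q ^ 2) / 4 * ((P - Q) / (P + Q))⁻¹ = ((P + Q) / 2) ^ 2 := by
    field_simp
    ring
  rw [← h1, mul_add, Complex.ofReal_mul, Complex.ofReal_inv]
  exact (add_sub_cancel_right _ _).symm

end StarParam

theorem exp_two_pi_mul_div_eq_pow (n j : ℕ) : Complex.exp (2 * Real.pi * Complex.I * j / n) =
    Complex.exp (2 * Real.pi * Complex.I / n) ^ j := by
  rw [← Complex.exp_nat_mul]
  congr 1
  ring

theorem mem_starSet_iff {n : ℕ} {C D : ℝ} (hn : 0 < n) (hC : 0 < C) (hD : 0 ≤ D) (z : ℂ) :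
    z ∈ starSet n C D ↔ ∃ x ∈ Set.Icc (C ^ n) (D ^ n), z ^ n = (x : ℂ) := by
  have hω := Complex.isPrimitiveRoot_exp n hn.ne'
  simp only [starSet, Set.mem_iUnion, exists_prop, Set.mem_image]
  constructor
  · rintro ⟨j, -, t, ⟨h1, h2⟩, rfl⟩
    refine ⟨t ^ n, ⟨pow_le_pow_left₀ hC.le h1 n, pow_le_pow_left₀ (hC.le.trans h1) h2 n⟩, ?_⟩
    rw [mul_pow, exp_two_pi_mul_div_eq_pow, ← pow_mul, mul_comm j, pow_mul, hω.pow_eq_one, one_pow,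
      one_mul, Complex.ofReal_pow]
  · rintro ⟨x, ⟨h1, h2⟩, hx⟩
    have hx0 : 0 < x := (pow_pos hC n).trans_le h1
    have hnorm : ‖z‖ ^ n = x := by
      rw [← norm_pow, hx, Complex.norm_real, Real.norm_of_nonneg hx0.le]
    have hz0 : (‖z‖ : ℂ) ≠ 0 := by
      intro h0
      rw [Complex.ofReal_eq_zero.1 h0, zero_pow hn.ne'] at hnorm
      exact hx0.ne hnorm
    have hCz : C ≤ ‖z‖ := by
      rw [← hnorm] at h1
      exact le_of_pow_le_pow_left₀ hn.ne' (norm_nonneg z) h1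
    have hzD : ‖z‖ ≤ D := by
      rw [← hnorm] at h2
      exact le_of_pow_le_pow_left₀ hn.ne' hD h2
    have hroot : (z / ‖z‖) ^ n = 1 := by
      rw [div_pow, ← Complex.ofReal_pow, hnorm, hx,
        div_self (Complex.ofReal_ne_zero.2 hx0.ne')]
    have : NeZero n := ⟨hn.ne'⟩
    obtain ⟨i, hi, hiz⟩ := hω.eq_pow_of_pow_eq_one hroot
    obtain ⟨j, hj, hjz⟩ : ∃ j ∈ Finset.Icc 1 n,
        Complex.exp (2 * Real.pi * Complex.I / n) ^ j = z / ‖z‖ := by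
      -- Roots of unity are indexed from `0` but the arms of the star from `1`; exponent `0` becomes
      -- `n`.
      rcases Nat.eq_zero_or_pos i with h0 | h0
      · refine ⟨n, Finset.mem_Icc.2 ⟨hn, le_rfl⟩, ?_⟩
        rw [hω.pow_eq_one, ← hiz, h0, pow_zero]
      · exact ⟨i, Finset.mem_Icc.2 ⟨h0, hi.le⟩, hiz⟩
    refine ⟨j, hj, ‖z‖, ⟨hCz, hzD⟩, ?_⟩
    rw [exp_two_pi_mul_div_eq_pow, hjz, div_mul_cancel₀ _ hz0]

theorem nodePoly_roots {n : ℕ} (hn : 0 < n) (r w : ℂ) :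
    nodePoly (fun j => Complex.exp (2 * Real.pi * Complex.I * j / n) * r) n w = w ^ n - r ^ n := by
  have h1 := congrArg (eval w) (X_pow_sub_C_eq_prod (Complex.isPrimitiveRoot_exp n hn.ne') hn
    (rfl : r ^ n = r ^ n))
  rw [eval_prod] at h1
  simp only [eval_sub, eval_pow, eval_X, eval_C] at h1
  rw [h1]
  exact Finset.prod_congr rfl fun j _ => by simp only [exp_two_pi_mul_div_eq_pow]

theorem exp_two_pi_mul_div_periodic {n : ℕ} (hn : 0 < n) (j : ℕ) :
    Complex.exp (2 * Real.pi * Complex.I * (j + n : ℕ) / n) =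
      Complex.exp (2 * Real.pi * Complex.I * j / n) := by
  rw [exp_two_pi_mul_div_eq_pow, exp_two_pi_mul_div_eq_pow, pow_add,
    (Complex.isPrimitiveRoot_exp n hn.ne').pow_eq_one, mul_one]

theorem injOn_exp_two_pi_mul {n : ℕ} (hn : 0 < n) {r : ℂ} (hr : r ≠ 0) :
    Set.InjOn (fun j : ℕ => Complex.exp (2 * Real.pi * Complex.I * j / n) * r) (Finset.range n) := by
  intro i hi j hj hij
  have hij := mul_right_cancel₀ hr hij
  rw [exp_two_pi_mul_div_eq_pow, exp_two_pi_mul_div_eq_pow] at hij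
  exact (Complex.isPrimitiveRoot_exp n hn.ne').pow_inj (Finset.mem_range.1 (Finset.mem_coe.1 hi))
    (Finset.mem_range.1 (Finset.mem_coe.1 hj)) hij

theorem starSet_faberWalsh_eq_chebyshev {n : ℕ} {C D : ℝ} (hn : 1 ≤ n) (hC : 0 < C) (hCD : C < D) :
    (∃ b : ℕ → ℂ[X], IsFaberWalsh (starSet n C D) (starFoci n C D) b) ∧
      ∀ b : ℕ → ℂ[X], IsFaberWalsh (starSet n C D) (starFoci n C D) b →
        ∀ (k : ℕ) (p : ℂ[X]), IsChebyshevPoly (starSet n C D) (n * k) p ↔ p = b (n * k) := by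
  have hD : 0 < D := hC.trans hCD
  have hn0 : (n : ℝ) ≠ 0 := Nat.cast_ne_zero.2 (by omega)
  set P : ℝ := D ^ ((n : ℝ) / 2) with hP
  set Q : ℝ := C ^ ((n : ℝ) / 2) with hQ
  have hsq : ∀ x : ℝ, 0 < x → (x ^ ((n : ℝ) / 2)) ^ 2 = x ^ n := fun x hx => by
    rw [← Real.rpow_natCast (x ^ _), ← Real.rpow_mul hx.le, Nat.cast_ofNat, div_mul_cancel₀ _ two_ne_zero,
      Real.rpow_natCast]
  have hQ0 : 0 < Q := Real.rpow_pos_of_pos hC _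
  have hPQ : Q < P := Real.rpow_lt_rpow hC.le hCD (by positivity)
  -- For `n = 1` the shift moves the single focus from `((P + Q) / 2) ^ 2` to `(P ^ 2 + Q ^ 2) / 2 =
  -- (C + D) / 2`, whence the separate case in `starRadius`.
  set t₂ : ℂ := if n = 1 then (((P - Q) ^ 2 / 4 : ℝ) : ℂ) else 0 with ht₂
  have hshift : (n = 1 ∧ t₂ = 0 + ((P - Q) ^ 2 / 4 : ℝ)) ∨ (2 ≤ n ∧ t₂ = 0) := by
    by_cases h1 : n = 1
    · left
      refine ⟨h1, ?_⟩
      rw [ht₂, if_pos h1, zero_add]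
    · right
      exact ⟨by omega, by rw [ht₂, if_neg h1]⟩
  have hstar : starSet n C D = (StarParam.ofRadii n P Q 0 t₂ hn hQ0 hPQ hshift).star := by
    ext z
    rw [mem_starSet_iff hn hC hD.le, StarParam.mem_star_ofRadii_iff, hsq D hD, hsq C hC, sub_zero]
  have hr : 0 < starRadius n C D := by
    rw [starRadius]
    split_ifs
    · linarith
    · exact Real.rpow_pos_of_pos (by positivity) _
  have hfoci : starFoci n C D = fun j : ℕ =>
    Complex.exp (2 * Real.pi * Complex.I * j / n) * (starRadius n C D : ℂ) := rfl
  rw [hstar]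
  refine StarParam.exists_isFaberWalsh_and_isChebyshevPoly_iff
    (S := StarParam.ofRadii n P Q 0 t₂ hn hQ0 hPQ hshift) (α := starFoci n C D) ?_ ?_ ?_
  · intro j
    change starFoci n C D (j + n) = _
    rw [starFoci, starFoci, exp_two_pi_mul_div_periodic hn]
  · intro w
    rw [StarParam.M_mul_eta_ofRadii]
    change nodePoly (starFoci n C D) n w = _
    rw [hfoci, nodePoly_roots hn, starRadius]
    by_cases h1 : n = 1
    · have h2 := hsq D hD
      have h3 := hsq C hC
      rw [← hP, h1, pow_one] at h2
      rw [← hQ, h1, pow_one] at h3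
      rw [ht₂, if_pos h1, if_pos h1, h1, pow_one, pow_one, ← h2, ← h3]
      push_cast
      ring
    · rw [ht₂, if_neg h1, if_neg h1, sub_zero, ← Complex.ofReal_pow,
        ← Real.rpow_natCast (_ ^ (2 / (n : ℝ))), ← Real.rpow_mul (by positivity),
        div_mul_cancel₀ _ hn0, ← hP, ← hQ, ← Nat.cast_ofNat (R := ℝ), Real.rpow_natCast]
  · exact injOn_exp_two_pi_mul hn (Complex.ofReal_ne_zero.2 hr.ne')

/-- Equal lengths make the set symmetric about `t = (B + C) / 2`, so it is `(z - t) ^ 2 ∈ [Q ^ 2, P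
^ 2]`, and the interval midpoints are the foci `t ± (P + Q) / 2`. -/
theorem twoIntervals_faberWalsh_eq_chebyshev {A B C D : ℝ} (hAB : A < B) (hBC : B < C)
    (h : B - A = D - C) :
    (∃ b : ℕ → ℂ[X], IsFaberWalsh (twoIntervals A B C D) (twoIntervalFoci A B C D) b) ∧
      ∀ b : ℕ → ℂ[X], IsFaberWalsh (twoIntervals A B C D) (twoIntervalFoci A B C D) b →
        ∀ (k : ℕ) (p : ℂ[X]),
          IsChebyshevPoly (twoIntervals A B C D) (2 * k) p ↔ p = b (2 * k) := by
  set P : ℝ := (D - A) / 2 with hP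
  set Q : ℝ := (C - B) / 2 with hQ
  set t : ℝ := (B + C) / 2 with ht
  have hA : A = t - P := by rw [hP, ht]; linarith
  have hB : B = t - Q := by rw [hQ, ht]; linarith
  have hC : C = t + Q := by rw [hQ, ht]; linarith
  have hD : D = t + P := by rw [hP, ht]; linarith
  have hQ0 : 0 < Q := by linarith
  have hPQ : Q < P := by linarith
  clear_value P Q t
  subst hA hB hC hD
  have hstar : twoIntervals (t - P) (t - Q) (t + Q) (t + P) =
      (StarParam.ofRadii 2 P Q t t two_pos hQ0 hPQ (Or.inr ⟨le_rfl, rfl⟩)).star := by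
    ext z
    rw [StarParam.mem_star_ofRadii_iff, twoIntervals]
    constructor
    · rintro ⟨x, hx, rfl⟩
      refine ⟨(x - t) ^ 2, ?_, by push_cast; rfl⟩
      rcases hx with ⟨h1, h2⟩ | ⟨h1, h2⟩ <;> constructor <;> nlinarith
    · rintro ⟨x, ⟨h1, h2⟩, hx⟩
      have hx0 : 0 ≤ x := (sq_nonneg Q).trans h1
      have h3 : Q ≤ √x := Real.le_sqrt_of_sq_le h1
      have h4 : √x ≤ P := (Real.sqrt_le_left (hQ0.trans hPQ).le).2 h2
      have h5 : (z - t) ^ 2 = ((√x : ℝ) : ℂ) ^ 2 := by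
        rw [hx, ← Complex.ofReal_pow, Real.sq_sqrt hx0]
      rcases sq_eq_sq_iff_eq_or_eq_neg.1 h5 with h6 | h6
      · exact ⟨t + √x, Or.inr ⟨by linarith, by linarith⟩, by
          push_cast
          linear_combination -h6⟩
      · exact ⟨t - √x, Or.inl ⟨by linarith, by linarith⟩, by
          push_cast
          linear_combination -h6⟩
  set α := twoIntervalFoci (t - P) (t - Q) (t + Q) (t + P) with hα
  have h0 : α 0 = t + ((P + Q) / 2 : ℝ) := by
    rw [hα, twoIntervalFoci, if_pos Even.zero]
    push_cast
    ring
  have h1 : α 1 = t - ((P + Q) / 2 : ℝ) := by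
    rw [hα, twoIntervalFoci, if_neg (by decide)]
    push_cast
    ring
  rw [hstar]
  refine StarParam.exists_isFaberWalsh_and_isChebyshevPoly_iff (α := α)
    (S := StarParam.ofRadii 2 P Q t t two_pos hQ0 hPQ (Or.inr ⟨le_rfl, rfl⟩)) ?_ ?_ ?_
  · intro j
    change α (j + 2) = α j
    simp only [hα, twoIntervalFoci, Nat.even_add, even_two, iff_true]
  · intro w
    rw [StarParam.M_mul_eta_ofRadii]
    change nodePoly α 2 w = _
    rw [nodePoly, Finset.prod_range_succ, Finset.prod_range_one, h0, h1]
    push_cast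
    ring
  · change Set.InjOn α (Finset.range 2)
    have hne : α 0 ≠ α 1 := by
      rw [h0, h1]
      intro h2
      have h3 : t + (P + Q) / 2 = t - (P + Q) / 2 := by exact_mod_cast h2
      linarith
    intro i hi j hj hij
    have hi := Finset.mem_range.1 (Finset.mem_coe.1 hi)
    have hj := Finset.mem_range.1 (Finset.mem_coe.1 hj)
    interval_cases i <;> interval_cases j
    · rfl
    · exact absurd hij hne
    · exact absurd hij.symm hne
    · rfl

theorem mainTheorem3 :
    (∀ (n : ℕ) (C D : ℝ), 1 ≤ n → 0 < C → C < D →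
      (∃ b : ℕ → ℂ[X], IsFaberWalsh (starSet n C D) (starFoci n C D) b) ∧
      ∀ b : ℕ → ℂ[X], IsFaberWalsh (starSet n C D) (starFoci n C D) b →
        ∀ (k : ℕ) (p : ℂ[X]), IsChebyshevPoly (starSet n C D) (n * k) p ↔ p = b (n * k)) ∧
    (∀ A B C D : ℝ, A < B → B < C → B - A = D - C →
      (∃ b : ℕ → ℂ[X], IsFaberWalsh (twoIntervals A B C D) (twoIntervalFoci A B C D) b) ∧
      ∀ b : ℕ → ℂ[X], IsFaberWalsh (twoIntervals A B C D) (twoIntervalFoci A B C D) b →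
        ∀ (k : ℕ) (p : ℂ[X]),
          IsChebyshevPoly (twoIntervals A B C D) (2 * k) p ↔ p = b (2 * k)) :=
  ⟨fun _ _ _ hn hC hCD => starSet_faberWalsh_eq_chebyshev hn hC hCD,
    fun _ _ _ _ hAB hBC h => twoIntervals_faberWalsh_eq_chebyshev hAB hBC h⟩
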